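/- Fix integers $M,k_1,k_2$ and $r_{m1},r_{m2}$ ($m=1,\dots,M$). For $m=1,\dots,M$ and $t=1,\dots,T$ let $$X_{mt}=R_mG_tC_m'+\Gamma_mF_{mt}\Lambda_m'+E_{mt}$$ be $N_m\times p$ random matrices, where $G_t$ ($k_1\times k_2$, global factors) and $F_{mt}$ ($r_{m1}\times r_{m2}$, local factors) are unobserved processes not depending on $N_1,\dots,N_M,p,T$, the loadings $R_m,C_m,\Gamma_m,\Lambda_m$ are deterministic matrices of sizes $N_m\times k_1$, $p\times k_2$, $N_m\times r_{m1}$, $p\times r_{m2}$, and $E_{mt}$ are errors. Put $N=N_1+\dots+N_M$ and let $N,p,T\to\infty$ (along a sequence, with loadings and errors depending on its index). With $x_{\cdot,j,mt}$ the $j$-th column of $X_{mt}$, define $$\Omega_{mi,j_1j_2}=\frac1T\sum_{t=1}^T\mathrm{Cov}(x_{\cdot,j_1,mt},x_{\cdot,j_2,it}),\qquad \widehat\Omega_{mi,j_1j_2}=\frac1T\sum_{t=1}^Tx_{\cdot,j_1,mt}x_{\cdot,j_2,it}',$$ $$W_{1,m}=\sum_{i\ne m}\sum_{j_1,j_2=1}^p\Omega_{mi,j_1j_2}\Omega_{mi,j_1j_2}',\qquad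 \widehat W_{1,m}=\sum_{i\ne m}\sum_{j_1,j_2=1}^p\widehat\Omega_{mi,j_1j_2}\widehat\Omega_{mi,j_1j_2}',$$ and let $W_{2,m}$ ($p\times p$) be obtained in the same way as $W_{1,m}$ from the transposed matrices $X_{mt}'$. Let $\lambda_{1m,1}\ge\dots\ge\lambda_{1m,N_m}$ and $\widehat\lambda_{1m,1}\ge\dots\ge\widehat\lambda_{1m,N_m}$ be the eigenvalues of $W_{1,m}$ and $\widehat W_{1,m}$. Write $\|\cdot\|_2$ for the spectral norm, $\sigma_j$ for the $j$-th largest singular value, $\|\cdot\|_{\min}$ for the smallest nonzero singular value, and $a\asymp b$ if $a=O(b)$ and $b=O(a)$. Assume the following. (0) All factors and errors have mean zero. The errors form a matrix white noise: they have finite variances, the families $(E_{1t},\dots,E_{Mt})$, $t=1,\dots,T$, are independent over $t$, and they are independent of the factors; and products of two simultaneous errors from different groups have second moments bounded uniformly in $t,N,p,T$ (this is implied by bounded error variances if errors of different groups are independent, and in general by bounded fourth moments). (1) The process $(\mathrm{vec}\,G_t,\mathrm{vec}\,F_{1t},\dots,\mathrm{vec}\,F_{Mt})$ is $\alpha$-mixing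 with $\sum_{k\ge1}\alpha(k)^{1-2/\gamma}<\infty$ for some $\gamma>2$. (2) The absolute moments of order $2\gamma$ of the entries of $G_t$ and $F_{mt}$ are bounded uniformly in $t$. $\Sigma_G=\mathrm{Var}(\mathrm{vec}\,G_t)$ has rank at least $k=\max(k_1,k_2)$ and $\|\Sigma_G\|_2\asymp1\asymp\sigma_k(\Sigma_G)$ (uniformly in $t$, if $\Sigma_G$ depends on $t$). For each row and each column of $F_{mt}$ there is a lag $1\le h\le h_0$ for which, for all large $T$, the averaged autocovariance matrix $\frac1{T-h}\sum_{t=1}^{T-h}\mathrm{Cov}(f_t,f_{t+h})$ of that row or column $f_t$ is nonzero. For each $m$, with $r_m=\max(r_{m1},r_{m2})$, there is $1\le h\le h_0$ such that $\Sigma_{fm}(h)=\frac1T\sum_{t=1}^{T-h}\mathrm{Cov}(\mathrm{vec}\,F_{mt},\mathrm{vec}\,F_{m,t+h})$ has rank at least $r_m$ for all large $T$ and $\|\Sigma_{fm}(h)\|_2\asymp1\asymp\sigma_{r_m}(\Sigma_{fm}(h))$. (3) The entries and the spectral norm of $\mathrm{Var}(\mathrm{vec}\,E_{mt})$ are bounded.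 (4) There are $\delta_1,\dots,\delta_4\in[0,1]$ such that for every $m$: $\|R_m\|_2^2\asymp N^{1-\delta_1}\asymp\|R_m\|_{\min}^2$, $\|C_m\|_2^2\asymp p^{1-\delta_2}\asymp\|C_m\|_{\min}^2$, both $A=\Gamma_m$ and $A=B_{1m}'\Gamma_m$ satisfy $\|A\|_2^2\asymp N^{1-\delta_3}\asymp\|A\|_{\min}^2$, and both $A=\Lambda_m$ and $A=B_{2m}'\Lambda_m$ satisfy $\|A\|_2^2\asymp p^{1-\delta_4}\asymp\|A\|_{\min}^2$. Here the columns of $B_{1m}$ ($N_m\times(N_m-k_1)$) and $B_{2m}$ ($p\times(p-k_2)$) are orthonormal eigenvectors of $W_{1,m}$ and $W_{2,m}$ for the eigenvalue $0$. (5) For $i=1,2$ and every $m$, $W_{i,m}$ has $k_i$ distinct positive eigenvalues. (6) For all $t$ and $m\ne n$, every entry of $F_{mt}$ is uncorrelated with every entry of $F_{nt}$, and every entry of $E_{mt}$ with every entry of $E_{nt}$; for all $t$ and $m$, every entry of $G_t$ is uncorrelated with every entry of $F_{mt}$. (7) $N_1,\dots,N_M$ and $N$ are of the same order of magnitude. Theorem.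 If also $N^{\delta_1}p^{\delta_2}T^{-1/2}\to0$, then for every $m=1,\dots,M$: $\lambda_{1m,j}=0$ for $j=k_1+1,\dots,N_m$, $$|\widehat\lambda_{1m,j}-\lambda_{1m,j}|=O_p\big(N^{2-\delta_1}p^{2-\delta_2}T^{-1/2}\big)\quad\text{for }j=1,\dots,k_1,$$ $$|\widehat\lambda_{1m,j}|=O_p\big(N^2p^2T^{-1}\big)\quad\text{for }j=k_1+1,\dots,N_m,$$ where in the last line $j$ may depend on $N_1,\dots,N_M,p,T$. -/

import Mathlib

open MeasureTheory ProbabilityTheory Filter Asymptotics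
open scoped Topology Matrix

noncomputable section

namespace MultilevelFactor

/-! ### Matrices: ordered eigenvalues, singular values, spectral norm -/

/-- `eigDesc A j` is the `j`-th largest eigenvalue (`j = 1, 2, …`, counted with multiplicity) of
the real symmetric matrix `A`. -/
def eigDesc {d : ℕ} (A : Matrix (Fin d) (Fin d) ℝ) (j : ℕ) : ℝ :=
  open Classical in
  if h : A.IsHermitian ∧ 1 ≤ j ∧ j ≤ d then
    h.1.eigenvalues₀ ⟨j - 1, by rw [Fintype.card_fin]; omega⟩
  else 0

/-- `sing A j` is the `j`-th largest singular value of `A` (`j = 1, 2, …`). -/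
def sing {a b : Type*} [Fintype a] [Fintype b] [DecidableEq b]
    (A : Matrix a b ℝ) (j : ℕ) : ℝ :=
  (Matrix.toEuclideanLin A).singularValues (j - 1)

/-- The smallest nonzero singular value of `A`. -/
def minSing {a b : Type*} [Fintype a] [Fintype b] [DecidableEq b] (A : Matrix a b ℝ) : ℝ :=
  sInf {s : ℝ | 0 < s ∧ ∃ j : ℕ, 1 ≤ j ∧ sing A j = s}

open scoped Matrix.Norms.L2Operator in
/-- The spectral norm. -/
def specNorm {a b : Type*} [Fintype a] [Fintype b] [DecidableEq b] (A : Matrix a b ℝ) : ℝ := ‖A‖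

/-- `‖A_n‖₂² ≍ a_n ≍ ‖A_n‖²_min` along the sequence of matrices `A_n`. -/
def HasStrength {a b : ℕ → ℕ} (A : ∀ n, Matrix (Fin (a n)) (Fin (b n)) ℝ) (rate : ℕ → ℝ) : Prop :=
  (fun n => specNorm (A n) ^ 2) =Θ[atTop] rate ∧ (fun n => minSing (A n) ^ 2) =Θ[atTop] rate

/-! ### Probability: stochastic order, covariance matrices, mixing -/

variable {Ω : Type*} [MeasurableSpace Ω]

/-- `X_n = O_p(a_n)`: for every `ε > 0` there is a `K` such that `P(|X_n| > K a_n) ≤ ε` for all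
large `n`. -/
def IsBigOp (μ : Measure Ω) (X : ℕ → Ω → ℝ) (a : ℕ → ℝ) : Prop :=
  ∀ ε : ℝ, 0 < ε → ∃ K : ℝ, ∀ᶠ n in atTop, μ {ω | K * a n < |X n ω|} ≤ ENNReal.ofReal ε

/-- The matrix `Cov(U, V)` of two random vectors. -/
def covMat (μ : Measure Ω) {a b : Type*} (U : Ω → a → ℝ) (V : Ω → b → ℝ) : Matrix a b ℝ :=
  Matrix.of fun i j => covariance (fun ω => U ω i) (fun ω => V ω j) μ

/-- The σ-field generated by `V t`, `t ∈ S`. -/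
abbrev sigmaGen {ι : Type*} (V : ℤ → Ω → ι → ℝ) (S : Set ℤ) : MeasurableSpace Ω :=
  ⨆ t ∈ S, MeasurableSpace.comap (V t) inferInstance

/-- The `α`-mixing (strong mixing) coefficient
`α(k) = sup_i sup {|P(A)P(B) - P(AB)| : A ∈ 𝓕_{-∞}^i, B ∈ 𝓕_{i+k}^∞}` of the vector process `V`. -/
def alphaMix (μ : Measure Ω) {ι : Type*} (V : ℤ → Ω → ι → ℝ) (k : ℕ) : ℝ :=
  sSup {x : ℝ | ∃ (i : ℤ) (A B : Set Ω), MeasurableSet[sigmaGen V (Set.Iic i)] A ∧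
    MeasurableSet[sigmaGen V (Set.Ici (i + k))] B ∧
    x = |μ.real A * μ.real B - μ.real (A ∩ B)|}

/-! ### The statistics `W` and `Ŵ` built from a family of matrix time series

`Y m t` is the `a m × b m` random matrix of group `m` at time `t`. -/

section Statistics

variable {M : ℕ} {a b : Fin M → ℕ} (Y : ∀ m, ℤ → Ω → Matrix (Fin (a m)) (Fin (b m)) ℝ) (T : ℕ)

/-- `(1/T) ∑_{t=1}^T Cov(j₁-th column of Y_{mt}, j₂-th column of Y_{it})`. -/
def popOmega (μ : Measure Ω) (m i : Fin M) (j₁ : Fin (b m)) (j₂ : Fin (b i)) :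
    Matrix (Fin (a m)) (Fin (a i)) ℝ :=
  (T : ℝ)⁻¹ • ∑ t ∈ Finset.Icc (1 : ℤ) T,
    covMat μ (fun ω => (Y m t ω).col j₁) (fun ω => (Y i t ω).col j₂)

/-- `(1/T) ∑_{t=1}^T (j₁-th column of Y_{mt}) (j₂-th column of Y_{it})'`. -/
def sampleOmega (m i : Fin M) (j₁ : Fin (b m)) (j₂ : Fin (b i)) (ω : Ω) :
    Matrix (Fin (a m)) (Fin (a i)) ℝ :=
  (T : ℝ)⁻¹ • ∑ t ∈ Finset.Icc (1 : ℤ) T,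
    Matrix.vecMulVec ((Y m t ω).col j₁) ((Y i t ω).col j₂)

/-- The population matrix `W_m`. -/
def popW (μ : Measure Ω) (m : Fin M) : Matrix (Fin (a m)) (Fin (a m)) ℝ :=
  ∑ i ∈ Finset.univ.erase m, ∑ j₁ : Fin (b m), ∑ j₂ : Fin (b i),
    popOmega Y T μ m i j₁ j₂ * (popOmega Y T μ m i j₁ j₂)ᵀ

/-- Its sample version `Ŵ_m`. -/
def sampleW (m : Fin M) (ω : Ω) : Matrix (Fin (a m)) (Fin (a m)) ℝ :=
  ∑ i ∈ Finset.univ.erase m, ∑ j₁ : Fin (b m), ∑ j₂ : Fin (b i),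
    sampleOmega Y T m i j₁ j₂ ω * (sampleOmega Y T m i j₁ j₂ ω)ᵀ

end Statistics

/-! ### The model -/

/-- The latent factor processes: the `k₁ × k₂` global factor `G t` and the `r₁ m × r₂ m` local
factor `F m t` of each of the `M` groups. -/
structure FactorProcess (Ω : Type*) (M k₁ k₂ : ℕ) (r₁ r₂ : Fin M → ℕ) where
  /-- global factors -/
  G : ℤ → Ω → Matrix (Fin k₁) (Fin k₂) ℝ
  /-- local factors -/
  F : ∀ m : Fin M, ℤ → Ω → Matrix (Fin (r₁ m)) (Fin (r₂ m)) ℝ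

/-- The part of the model that changes along the asymptotics: sizes, loadings and errors.
The errors are relevant for times `1, …, T` only. -/
structure Panel (Ω : Type*) (M k₁ k₂ : ℕ) (r₁ r₂ : Fin M → ℕ) where
  /-- number of individuals in each group -/
  N : Fin M → ℕ
  /-- number of columns -/
  p : ℕ
  /-- number of observed times -/
  T : ℕ
  /-- front global loadings -/
  R : ∀ m, Matrix (Fin (N m)) (Fin k₁) ℝ
  /-- back global loadings -/
  C : ∀ _ : Fin M, Matrix (Fin p) (Fin k₂) ℝ
  /-- front local loadings -/
  Γ : ∀ m, Matrix (Fin (N m)) (Fin (r₁ m)) ℝ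
  /-- back local loadings -/
  Λ : ∀ m, Matrix (Fin p) (Fin (r₂ m)) ℝ
  /-- errors -/
  E : ∀ m, ℤ → Ω → Matrix (Fin (N m)) (Fin p) ℝ

variable {M k₁ k₂ : ℕ} {r₁ r₂ : Fin M → ℕ}

namespace FactorProcess

variable (Φ : FactorProcess Ω M k₁ k₂ r₁ r₂)

/-- The joint vector process `(vec G_t, vec F_{1t}, …, vec F_{Mt})`. -/
def joint (t : ℤ) (ω : Ω) : (Fin k₂ × Fin k₁) ⊕ (Σ m : Fin M, Fin (r₂ m) × Fin (r₁ m)) → ℝ :=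
  Sum.elim (Φ.G t ω).vec fun x => (Φ.F x.1 t ω).vec x.2

/-- `Σ_G = Var(vec G_t)`. -/
def SigmaG (μ : Measure Ω) (t : ℤ) : Matrix (Fin k₂ × Fin k₁) (Fin k₂ × Fin k₁) ℝ :=
  covMat μ (fun ω => (Φ.G t ω).vec) (fun ω => (Φ.G t ω).vec)

/-- `Σ_{fm}(h) = (1/T) ∑_{t=1}^{T-h} Cov(vec F_{mt}, vec F_{m,t+h})`. -/
def SigmaF (μ : Measure Ω) (m : Fin M) (h T : ℕ) :
    Matrix (Fin (r₂ m) × Fin (r₁ m)) (Fin (r₂ m) × Fin (r₁ m)) ℝ :=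
  (T : ℝ)⁻¹ • ∑ t ∈ Finset.Icc (1 : ℤ) (T - h),
    covMat μ (fun ω => (Φ.F m t ω).vec) (fun ω => (Φ.F m (t + h) ω).vec)

/-- Averaged lag-`h` autocovariance matrix of the `i`-th row of `F_{mt}`. -/
def rowAutocov (μ : Measure Ω) (m : Fin M) (i : Fin (r₁ m)) (h T : ℕ) :
    Matrix (Fin (r₂ m)) (Fin (r₂ m)) ℝ :=
  ((T : ℝ) - h)⁻¹ • ∑ t ∈ Finset.Icc (1 : ℤ) (T - h),
    covMat μ (fun ω => (Φ.F m t ω).row i) (fun ω => (Φ.F m (t + h) ω).row i)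

/-- Averaged lag-`h` autocovariance matrix of the `j`-th column of `F_{mt}`. -/
def colAutocov (μ : Measure Ω) (m : Fin M) (j : Fin (r₂ m)) (h T : ℕ) :
    Matrix (Fin (r₁ m)) (Fin (r₁ m)) ℝ :=
  ((T : ℝ) - h)⁻¹ • ∑ t ∈ Finset.Icc (1 : ℤ) (T - h),
    covMat μ (fun ω => (Φ.F m t ω).col j) (fun ω => (Φ.F m (t + h) ω).col j)

end FactorProcess

namespace Panel

variable (P : Panel Ω M k₁ k₂ r₁ r₂) (Φ : FactorProcess Ω M k₁ k₂ r₁ r₂)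

/-- The total number of individuals `N = N_1 + ⋯ + N_M`. -/
def total : ℕ := ∑ m, P.N m

/-- The observations `X_{mt} = R_m G_t C_m' + Γ_m F_{mt} Λ_m' + E_{mt}`. -/
def X (m : Fin M) (t : ℤ) (ω : Ω) : Matrix (Fin (P.N m)) (Fin P.p) ℝ :=
  P.R m * Φ.G t ω * (P.C m)ᵀ + P.Γ m * Φ.F m t ω * (P.Λ m)ᵀ + P.E m t ω

/-- `W_{1,m}`, an `N_m × N_m` matrix. -/
def W₁ (μ : Measure Ω) (m : Fin M) : Matrix (Fin (P.N m)) (Fin (P.N m)) ℝ :=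
  popW (P.X Φ) P.T μ m

/-- `Ŵ_{1,m}`. -/
def hatW₁ (m : Fin M) (ω : Ω) : Matrix (Fin (P.N m)) (Fin (P.N m)) ℝ :=
  sampleW (P.X Φ) P.T m ω

/-- `W_{2,m}`, a `p × p` matrix: the same construction for the transposed observations. -/
def W₂ (μ : Measure Ω) (m : Fin M) : Matrix (Fin P.p) (Fin P.p) ℝ :=
  popW (a := fun _ => P.p) (fun m t ω => (P.X Φ m t ω)ᵀ) P.T μ m

/-- `Σ_{em} = Var(vec E_{mt})`. -/
def SigmaE (μ : Measure Ω) (m : Fin M) (t : ℤ) :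
    Matrix (Fin P.p × Fin (P.N m)) (Fin P.p × Fin (P.N m)) ℝ :=
  covMat μ (fun ω => (P.E m t ω).vec) (fun ω => (P.E m t ω).vec)

/-- All errors at time `t`, as one vector. -/
def jointE (t : ℤ) (ω : Ω) : (Σ m : Fin M, Fin P.p × Fin (P.N m)) → ℝ :=
  fun x => (P.E x.1 t ω).vec x.2

end Panel

/-! ### The assumptions

Throughout, `P n`, `n = 0, 1, 2, …`, is the sequence along which the sizes tend to infinity. -/

variable (μ : Measure Ω) (Φ : FactorProcess Ω M k₁ k₂ r₁ r₂) (P : ℕ → Panel Ω M k₁ k₂ r₁ r₂)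

/-- `N, p, T → ∞`. -/
structure SizesTendToInfinity : Prop where
  N : Tendsto (fun n => (P n).total) atTop atTop
  p : Tendsto (fun n => (P n).p) atTop atTop
  T : Tendsto (fun n => (P n).T) atTop atTop

/-- The factors are random variables with mean zero. -/
structure CenteredFactors : Prop where
  measurable_G : ∀ t i j, Measurable fun ω => Φ.G t ω i j
  measurable_F : ∀ m t i j, Measurable fun ω => Φ.F m t ω i j
  mean_G : ∀ t, 1 ≤ t → ∀ i j, ∫ ω, Φ.G t ω i j ∂μ = 0
  mean_F : ∀ m t, 1 ≤ t → ∀ i j, ∫ ω, Φ.F m t ω i j ∂μ = 0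

/-- The errors form a matrix white noise: they have mean zero and finite variances, and are
independent over time and independent of the factors.  Products of two errors from different
groups have uniformly bounded second moments. -/
structure WhiteNoise : Prop where
  measurable : ∀ n m t i j, Measurable fun ω => (P n).E m t ω i j
  memLp : ∀ n m, ∀ t ∈ Set.Icc (1 : ℤ) (P n).T, ∀ i j, MemLp (fun ω => (P n).E m t ω i j) 2 μ
  mean : ∀ n m, ∀ t ∈ Set.Icc (1 : ℤ) (P n).T, ∀ i j, ∫ ω, (P n).E m t ω i j ∂μ = 0
  indep_time : ∀ n, iIndepFun (fun (t : Set.Icc (1 : ℤ) (P n).T) ω => (P n).jointE t ω) μ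
  indep_factors : ∀ n, IndepFun
    (fun ω (t : Set.Icc (1 : ℤ) (P n).T) => (P n).jointE t ω)
    (fun ω (t : Set.Icc (1 : ℤ) (P n).T) => Φ.joint t ω) μ
  cross_moment : ∃ K : ℝ, ∀ n, ∀ m m', m ≠ m' → ∀ t ∈ Set.Icc (1 : ℤ) (P n).T, ∀ i j i' j',
    ∫⁻ ω, ENNReal.ofReal (((P n).E m t ω i j * (P n).E m' t ω i' j') ^ 2) ∂μ ≤ ENNReal.ofReal K

/-- Strong mixing of the joint factor process. -/
structure FactorMixing (γ : ℝ) : Prop where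
  two_lt : 2 < γ
  summable : Summable fun k : ℕ => alphaMix μ Φ.joint (k + 1) ^ (1 - 2 / γ)

/-- Bounded moments of order `2γ` and nondegeneracy of the factors. -/
structure FactorMoments (γ : ℝ) (h₀ : ℕ) : Prop where
  moments : ∃ K : ℝ,
    (∀ t, 1 ≤ t → ∀ i j, ∫⁻ ω, ENNReal.ofReal (|Φ.G t ω i j| ^ (2 * γ)) ∂μ ≤ ENNReal.ofReal K) ∧
    (∀ m t, 1 ≤ t → ∀ i j,
      ∫⁻ ω, ENNReal.ofReal (|Φ.F m t ω i j| ^ (2 * γ)) ∂μ ≤ ENNReal.ofReal K)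
  rank_G : ∀ t, 1 ≤ t → max k₁ k₂ ≤ (Φ.SigmaG μ t).rank
  scale_G : ∃ c K : ℝ, 0 < c ∧ ∀ t, 1 ≤ t →
    c ≤ sing (Φ.SigmaG μ t) (max k₁ k₂) ∧ specNorm (Φ.SigmaG μ t) ≤ K
  row_F : ∀ m i, ∃ h, 1 ≤ h ∧ h ≤ h₀ ∧ ∀ᶠ n in atTop, Φ.rowAutocov μ m i h (P n).T ≠ 0
  col_F : ∀ m j, ∃ h, 1 ≤ h ∧ h ≤ h₀ ∧ ∀ᶠ n in atTop, Φ.colAutocov μ m j h (P n).T ≠ 0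
  lag_F : ∀ m, ∃ h, 1 ≤ h ∧ h ≤ h₀ ∧
    (∀ᶠ n in atTop, max (r₁ m) (r₂ m) ≤ (Φ.SigmaF μ m h (P n).T).rank) ∧
    (fun n => specNorm (Φ.SigmaF μ m h (P n).T)) =Θ[atTop] (fun _ => (1 : ℝ)) ∧
    (fun n => sing (Φ.SigmaF μ m h (P n).T) (max (r₁ m) (r₂ m))) =Θ[atTop] (fun _ => (1 : ℝ))

/-- The entries and the spectral norm of the error covariance matrices are bounded. -/
def BoundedNoise : Prop :=
  ∃ K : ℝ, ∀ n m, ∀ t ∈ Set.Icc (1 : ℤ) (P n).T,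
    (∀ x y, |(P n).SigmaE μ m t x y| ≤ K) ∧ specNorm ((P n).SigmaE μ m t) ≤ K

/-- The strengths `δ₁, δ₂` of the global and `δ₃, δ₄` of the local factors.  The columns of
`B₁ n m` and `B₂ n m` are orthonormal eigenvectors of `W_{1,m}` and `W_{2,m}` for the
eigenvalue zero, `N_m - k₁` and `p - k₂` of them; the singular values in question do not depend on
their choice. -/
structure FactorStrength (δ₁ δ₂ δ₃ δ₄ : ℝ) : Prop where
  mem : δ₁ ∈ Set.Icc (0 : ℝ) 1 ∧ δ₂ ∈ Set.Icc (0 : ℝ) 1 ∧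
    δ₃ ∈ Set.Icc (0 : ℝ) 1 ∧ δ₄ ∈ Set.Icc (0 : ℝ) 1
  R : ∀ m, HasStrength (fun n => (P n).R m) (fun n => ((P n).total : ℝ) ^ (1 - δ₁))
  C : ∀ m, HasStrength (fun n => (P n).C m) (fun n => ((P n).p : ℝ) ^ (1 - δ₂))
  Γ : ∀ m, HasStrength (fun n => (P n).Γ m) (fun n => ((P n).total : ℝ) ^ (1 - δ₃))
  Λ : ∀ m, HasStrength (fun n => (P n).Λ m) (fun n => ((P n).p : ℝ) ^ (1 - δ₄))
  BΓ : ∀ m, ∃ B : ∀ n, Matrix (Fin ((P n).N m)) (Fin ((P n).N m - k₁)) ℝ,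
    (∀ n, (B n)ᵀ * B n = 1 ∧ (P n).W₁ Φ μ m * B n = 0) ∧
    HasStrength (fun n => (B n)ᵀ * (P n).Γ m) (fun n => ((P n).total : ℝ) ^ (1 - δ₃))
  BΛ : ∀ m, ∃ B : ∀ n, Matrix (Fin (P n).p) (Fin ((P n).p - k₂)) ℝ,
    (∀ n, (B n)ᵀ * B n = 1 ∧ (P n).W₂ Φ μ m * B n = 0) ∧
    HasStrength (fun n => (B n)ᵀ * (P n).Λ m) (fun n => ((P n).p : ℝ) ^ (1 - δ₄))

/-- `W_{1,m}` has `k₁` and `W_{2,m}` has `k₂` distinct positive eigenvalues. -/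
structure DistinctEigenvalues : Prop where
  pos₁ : ∀ n m j, 1 ≤ j → j ≤ k₁ → 0 < eigDesc ((P n).W₁ Φ μ m) j
  anti₁ : ∀ n m j, 1 ≤ j → j < k₁ → eigDesc ((P n).W₁ Φ μ m) (j + 1) < eigDesc ((P n).W₁ Φ μ m) j
  pos₂ : ∀ n m j, 1 ≤ j → j ≤ k₂ → 0 < eigDesc ((P n).W₂ Φ μ m) j
  anti₂ : ∀ n m j, 1 ≤ j → j < k₂ → eigDesc ((P n).W₂ Φ μ m) (j + 1) < eigDesc ((P n).W₂ Φ μ m) j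

/-- Global factors, local factors of the different groups, and errors of the different groups are
uncorrelated. -/
structure Uncorrelated : Prop where
  FF : ∀ m m', m ≠ m' → ∀ t, 1 ≤ t → ∀ i j i' j', ∫ ω, Φ.F m t ω i j * Φ.F m' t ω i' j' ∂μ = 0
  GF : ∀ m t, 1 ≤ t → ∀ i j i' j', ∫ ω, Φ.G t ω i j * Φ.F m t ω i' j' ∂μ = 0
  EE : ∀ n, ∀ m m', m ≠ m' → ∀ t ∈ Set.Icc (1 : ℤ) (P n).T, ∀ i j i' j',
    ∫ ω, (P n).E m t ω i j * (P n).E m' t ω i' j' ∂μ = 0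

/-- All group sizes are of the order of the total size. -/
def ComparableGroups : Prop :=
  ∀ m, (fun n => ((P n).N m : ℝ)) =Θ[atTop] fun n => ((P n).total : ℝ)

end MultilevelFactor

end

open MultilevelFactor

/-!
The matrix `W_{1,m}` is a Gram matrix `Y'Y`, where `Y` stacks the blocks `Ω_{mi,j₁j₂}'`, and `Ŵ_{1,m}`
is `X'X` with the sample blocks in their place (`W₁_eq_gram`, `hatW₁_eq_gram`). Write `S` and `D` for
the squared Frobenius norms of `Y` and of `X - Y`.

*Rank.* Only the global factors correlate different groups, so every block `Ω_{mi,j₁j₂}` has the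
form `R_m (⋯)` and `Y v = 0` whenever `R_m' v = 0` (`popStack_mulVec_eq_zero`). By Courant–Fischer,
the eigenvalues of `Y'Y` beyond the `k₁`-th vanish, and those of `X'X` are at most `D`, since `X`
and `X - Y` agree on the kernel of `R_m'` (`eigDesc_gram_le_of_vanish`): the cross terms, which are
linear in `X - Y`, do not reach them.

*Perturbation.* By Weyl's inequality and `|x² - y²| ≤ τ y² + (1 + τ⁻¹) (x - y)²`, all eigenvalues
satisfy `|λ̂_j - λ_j| ≤ τ S + (1 + τ⁻¹) D` for every `τ > 0` (`abs_eigDesc_gram_sub_le`).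

*Orders of magnitude.* The strength of the loadings gives `S = O(N^{2-2δ₁} p^{2-2δ₂})`
(`sqSum_popStack_le`), and `D = O_p(N² p² T⁻¹)` because its expectation has this order
(`exists_integral_deviationBound_le`). For the latter the vectorized observations are written as
`x_m = L_m f_m + e_m`, with `f_m` the factors seen by group `m` and `L_m` the Kronecker products of
the loadings; then `D` is controlled by time averages of centered products of two factors, of a
factor and an error, and of two errors from different groups. Each such average has second moment
`O(T⁻¹)`: the last two kinds are sums of orthogonal variables, the first is a sum over a strongly
mixing sequence, treated by Davydov's covariance inequality (`abs_cov_le_of_mixing`). The choice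
`τ = N^{δ₁} p^{δ₂} T^{-1/2} → 0` then gives the stated rates.
-/

namespace MultilevelFactor

/-! ### Ordered eigenvalues and quadratic forms -/

/-- Spectral theorem in the ordering of `eigDesc`: `U` is orthogonal, and in the coordinates `Uᵀ v`
the quadratic form of `A` is diagonal with the eigenvalues in descending order. -/
lemma exists_orthogonal_quadForm {d : ℕ} {A : Matrix (Fin d) (Fin d) ℝ} (hA : A.IsHermitian) :
    ∃ U : Matrix (Fin d) (Fin d) ℝ,
      (∀ v, v ⬝ᵥ A *ᵥ v = ∑ i : Fin d, eigDesc A (i + 1) * (Uᵀ *ᵥ v) i ^ 2) ∧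
      ∀ v, v ⬝ᵥ v = ∑ i, (Uᵀ *ᵥ v) i ^ 2 := by
  classical
  set e : Fin d ≃ Fin d :=
    (finCongr (Fintype.card_fin d)).symm.trans (Fintype.equivOfCardEq (Fintype.card_fin _)) with he
  have hev : ∀ i : Fin d, eigDesc A (i + 1) = hA.eigenvalues (e i) := by
    intro i
    have hi : A.IsHermitian ∧ 1 ≤ (i : ℕ) + 1 ∧ (i : ℕ) + 1 ≤ d := ⟨hA, by omega, by omega⟩
    rw [eigDesc, dif_pos hi, Matrix.IsHermitian.eigenvalues]
    congr 1
    simp [he]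
    ext
    simp
  set b := hA.eigenvectorBasis with hb
  have hdot : ∀ v w : EuclideanSpace ℝ (Fin d), inner ℝ v w = v.ofLp ⬝ᵥ w.ofLp := by
    intro v w
    rw [EuclideanSpace.inner_eq_star_dotProduct, dotProduct_comm]; simp
  refine ⟨Matrix.of fun i j => (b (e j)).ofLp i, fun v => ?_, fun v => ?_⟩
  all_goals
    have hco : ∀ i, ((Matrix.of fun i j => (b (e j)).ofLp i)ᵀ *ᵥ v) i
        = inner ℝ (b (e i)) (WithLp.toLp 2 v) := by
      intro i; rw [hdot]; rfl
    simp only [hco]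
  · have h1 := b.sum_inner_mul_inner (WithLp.toLp 2 v) (WithLp.toLp 2 (A *ᵥ v))
    rw [hdot] at h1
    rw [← h1, ← e.sum_comp]
    refine Finset.sum_congr rfl fun i _ => ?_
    rw [hev, hdot (b (e i)) (WithLp.toLp 2 (A *ᵥ v)), Matrix.dotProduct_mulVec]
    have h2 : (b (e i)).ofLp ᵥ* A = hA.eigenvalues (e i) • (b (e i)).ofLp := by
      have h3 := hA.mulVec_eigenvectorBasis (e i)
      rw [← Matrix.mulVec_transpose]
      have : Aᵀ = A := by simpa [Matrix.IsHermitian] using hA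
      rw [this, h3]
    rw [h2, smul_dotProduct, real_inner_comm, hdot (b (e i))]
    simp only [smul_eq_mul]
    ring
  · have h1 := b.sum_inner_mul_inner (WithLp.toLp 2 v) (WithLp.toLp 2 v)
    rw [hdot] at h1
    rw [← h1, ← e.sum_comp]
    refine Finset.sum_congr rfl fun i _ => ?_
    rw [real_inner_comm]; ring

lemma eigDesc_antitone {d : ℕ} {A : Matrix (Fin d) (Fin d) ℝ} {i j : ℕ} (hA : A.IsHermitian)
    (hi : 1 ≤ i) (hij : i ≤ j) (hj : j ≤ d) : eigDesc A j ≤ eigDesc A i := by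
  rw [eigDesc, eigDesc, dif_pos ⟨hA, hi.trans hij, hj⟩, dif_pos ⟨hA, hi, hij.trans hj⟩]
  apply hA.eigenvalues₀_antitone
  simp only [Fin.mk_le_mk]
  omega

/-- One half of the Courant–Fischer principle: if the quadratic form of `A` is at most `c ‖v‖²` on
a subspace of codimension less than `j` (the kernel of `L`), the `j`-th eigenvalue is at most
`c`. -/
lemma eigDesc_le_of_quadForm_le {d j : ℕ} {A : Matrix (Fin d) (Fin d) ℝ} (hA : A.IsHermitian)
    {V : Type*} [AddCommGroup V] [Module ℝ V] [FiniteDimensional ℝ V]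
    (L : (Fin d → ℝ) →ₗ[ℝ] V) (hL : Module.finrank ℝ V < j) (hj : j ≤ d) {c : ℝ}
    (hc : ∀ v, L v = 0 → v ⬝ᵥ A *ᵥ v ≤ c * (v ⬝ᵥ v)) : eigDesc A j ≤ c := by
  obtain ⟨U, hU, hU'⟩ := exists_orthogonal_quadForm hA
  -- Coordinates along the eigenvectors after the `j`-th.
  let K : (Fin d → ℝ) →ₗ[ℝ] ({i : Fin d // j ≤ i} → ℝ) :=
    (LinearMap.funLeft ℝ ℝ Subtype.val).comp (Matrix.mulVecLin Uᵀ)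
  have hcard : Fintype.card {i : Fin d // j ≤ i} = d - j := by
    rw [Fintype.card_subtype]
    have h2 : (Finset.univ.filter fun i : Fin d => j ≤ i) =
        (Finset.univ.filter fun i : Fin d => (i : ℕ) < j)ᶜ := by
      ext; simp
    rw [h2, Finset.card_compl, Fin.card_filter_val_lt]
    simp [hj]
  have hker : LinearMap.ker (L.prod K) ≠ ⊥ := by
    apply LinearMap.ker_ne_bot_of_finrank_lt
    rw [Module.finrank_prod, Module.finrank_fintype_fun_eq_card, hcard,
      Module.finrank_fintype_fun_eq_card, Fintype.card_fin]
    omega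
  obtain ⟨v, hv, hv0⟩ := Submodule.exists_mem_ne_zero_of_ne_bot hker
  simp only [LinearMap.mem_ker, LinearMap.prod_apply, Function.prod_apply, Prod.mk_eq_zero] at hv
  have hpos : 0 < v ⬝ᵥ v := by
    have h0 : 0 ≤ v ⬝ᵥ v := Finset.sum_nonneg fun i _ => mul_self_nonneg _
    refine lt_of_le_of_ne h0 fun h => hv0 (dotProduct_self_eq_zero.1 h.symm)
  refine le_of_mul_le_mul_right (le_trans ?_ (hc v hv.1)) hpos
  rw [hU, hU', Finset.mul_sum]
  refine Finset.sum_le_sum fun i _ => ?_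
  by_cases hi : j ≤ i
  · have : (Uᵀ *ᵥ v) i = 0 := congrFun hv.2 ⟨i, hi⟩
    simp [this]
  · exact mul_le_mul_of_nonneg_right (eigDesc_antitone hA (by omega) (by omega) hj) (sq_nonneg _)

/-- Weyl's inequality: a bound on the difference of two quadratic forms is a bound on the
difference of ordered eigenvalues. -/
lemma eigDesc_le_eigDesc_add {d j : ℕ} {A B : Matrix (Fin d) (Fin d) ℝ} (hA : A.IsHermitian)
    (hB : B.IsHermitian) (hj1 : 1 ≤ j) (hj : j ≤ d) {c : ℝ}
    (h : ∀ v, v ⬝ᵥ A *ᵥ v ≤ v ⬝ᵥ B *ᵥ v + c * (v ⬝ᵥ v)) :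
    eigDesc A j ≤ eigDesc B j + c := by
  obtain ⟨U, hU, hU'⟩ := exists_orthogonal_quadForm hB
  let L : (Fin d → ℝ) →ₗ[ℝ] (Fin (j - 1) → ℝ) :=
    (LinearMap.funLeft ℝ ℝ (Fin.castLE (by omega))).comp (Matrix.mulVecLin Uᵀ)
  refine eigDesc_le_of_quadForm_le hA L (by simp; omega) hj fun v hv => (h v).trans ?_
  rw [add_mul]
  refine add_le_add ?_ le_rfl
  rw [hU, hU', Finset.mul_sum]
  refine Finset.sum_le_sum fun i _ => ?_
  by_cases hi : (i : ℕ) < j - 1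
  · have : (Uᵀ *ᵥ v) i = 0 := congrFun hv ⟨i, hi⟩
    simp [this]
  · exact mul_le_mul_of_nonneg_right (eigDesc_antitone hB hj1 (by omega) (by omega)) (sq_nonneg _)

lemma eigDesc_nonneg {d j : ℕ} {A : Matrix (Fin d) (Fin d) ℝ} (hA : A.PosSemidef) :
    0 ≤ eigDesc A j := by
  unfold eigDesc
  split_ifs with h
  · have := hA.eigenvalues_nonneg ((Fintype.equivOfCardEq (Fintype.card_fin _))
      ⟨j - 1, by rw [Fintype.card_fin]; omega⟩)
    simpa [Matrix.IsHermitian.eigenvalues] using this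
  · exact le_rfl

lemma eigDesc_eq_zero_of_not_le {d j : ℕ} (A : Matrix (Fin d) (Fin d) ℝ) (hj : ¬ j ≤ d) :
    eigDesc A j = 0 := by
  rw [eigDesc, dif_neg (fun h => hj h.2.2)]

/-! ### Eigenvalues of Gram matrices -/

section Gram

variable {κ : Type*} [Fintype κ] {d : ℕ}

/-- The sum of the squares of the entries of `A`, the square of its Frobenius norm. -/
def sqSum {ι κ : Type*} [Fintype ι] [Fintype κ] (A : Matrix ι κ ℝ) : ℝ := ∑ i, ∑ j, A i j ^ 2

lemma sqSum_nonneg {ι κ : Type*} [Fintype ι] [Fintype κ] (A : Matrix ι κ ℝ) : 0 ≤ sqSum A :=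
  Finset.sum_nonneg fun _ _ => Finset.sum_nonneg fun _ _ => sq_nonneg _

lemma posSemidef_gram (X : Matrix κ (Fin d) ℝ) : (Xᵀ * X).PosSemidef := by
  simpa using Matrix.posSemidef_conjTranspose_mul_self X

lemma quadForm_gram (X : Matrix κ (Fin d) ℝ) (v : Fin d → ℝ) :
    v ⬝ᵥ (Xᵀ * X) *ᵥ v = ∑ k, (X *ᵥ v) k ^ 2 := by
  rw [← Matrix.mulVec_mulVec, Matrix.dotProduct_mulVec, Matrix.vecMul_transpose]
  simp [dotProduct, sq]

lemma sum_sq_mulVec_le (X : Matrix κ (Fin d) ℝ) (v : Fin d → ℝ) :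
    ∑ k, (X *ᵥ v) k ^ 2 ≤ sqSum X * (v ⬝ᵥ v) := by
  rw [sqSum, Finset.sum_mul]
  refine Finset.sum_le_sum fun k _ => ?_
  have := Finset.sum_mul_sq_le_sq_mul_sq Finset.univ (fun i => X k i) v
  simpa [Matrix.mulVec, dotProduct, sq] using this

/-- The quadratic forms of two Gram matrices compared by
`|x² - y²| ≤ τ y² + (1 + τ⁻¹) (x - y)²`. -/
lemma abs_quadForm_gram_sub_le (X Y : Matrix κ (Fin d) ℝ) {τ : ℝ} (hτ : 0 < τ) (v : Fin d → ℝ) :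
    |v ⬝ᵥ (Xᵀ * X) *ᵥ v - v ⬝ᵥ (Yᵀ * Y) *ᵥ v| ≤
      (τ * sqSum Y + (1 + τ⁻¹) * sqSum (X - Y)) * (v ⬝ᵥ v) := by
  have hτ' : 0 < τ⁻¹ := inv_pos.2 hτ
  rw [quadForm_gram, quadForm_gram, ← Finset.sum_sub_distrib]
  have key : ∀ k, |(X *ᵥ v) k ^ 2 - (Y *ᵥ v) k ^ 2| ≤
      τ * (Y *ᵥ v) k ^ 2 + (1 + τ⁻¹) * ((X - Y) *ᵥ v) k ^ 2 := by
    intro k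
    rw [Matrix.sub_mulVec, Pi.sub_apply]
    set x := (X *ᵥ v) k
    set y := (Y *ᵥ v) k
    have h1 : τ⁻¹ * (τ * y - (x - y)) ^ 2
        = τ * y ^ 2 - 2 * y * (x - y) + τ⁻¹ * (x - y) ^ 2 := by
      field_simp
      ring
    have h2 : τ⁻¹ * (τ * y + (x - y)) ^ 2
        = τ * y ^ 2 + 2 * y * (x - y) + τ⁻¹ * (x - y) ^ 2 := by
      field_simp
      ring
    have h3 := mul_nonneg hτ'.le (sq_nonneg (τ * y - (x - y)))
    have h4 := mul_nonneg hτ'.le (sq_nonneg (τ * y + (x - y)))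
    rw [abs_le]
    constructor <;> nlinarith [sq_nonneg (x - y)]
  have h1 := (Finset.abs_sum_le_sum_abs _ _).trans
    (Finset.sum_le_sum fun k (_ : k ∈ Finset.univ) => key k)
  rw [Finset.sum_add_distrib, ← Finset.mul_sum, ← Finset.mul_sum] at h1
  have h2 := mul_le_mul_of_nonneg_left (sum_sq_mulVec_le (X - Y) v)
    (show 0 ≤ 1 + τ⁻¹ by positivity)
  have h3 := mul_le_mul_of_nonneg_left (sum_sq_mulVec_le Y v) hτ.le
  linarith

lemma abs_eigDesc_gram_sub_le (X Y : Matrix κ (Fin d) ℝ) {τ : ℝ} (hτ : 0 < τ) {j : ℕ}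
    (hj : 1 ≤ j) :
    |eigDesc (Xᵀ * X) j - eigDesc (Yᵀ * Y) j| ≤
      τ * sqSum Y + (1 + τ⁻¹) * sqSum (X - Y) := by
  have hX := sqSum_nonneg (X - Y)
  have hY := sqSum_nonneg Y
  by_cases hjd : j ≤ d
  swap
  · rw [eigDesc_eq_zero_of_not_le _ hjd, eigDesc_eq_zero_of_not_le _ hjd, sub_zero, abs_zero]
    positivity
  have h := fun v => abs_le.1 (abs_quadForm_gram_sub_le X Y hτ v)
  have h1 := eigDesc_le_eigDesc_add (posSemidef_gram X).isHermitian (posSemidef_gram Y).isHermitian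
    hj hjd fun v => sub_le_iff_le_add'.1 (h v).2
  have h2 := eigDesc_le_eigDesc_add (posSemidef_gram Y).isHermitian (posSemidef_gram X).isHermitian
    (c := τ * sqSum Y + (1 + τ⁻¹) * sqSum (X - Y)) hj hjd fun v => by linarith [(h v).1]
  rw [abs_le]
  constructor <;> linarith

/-- If `Y` vanishes on the kernel of `L`, the eigenvalues of `XᵀX` beyond the rank of `L` feel only
the difference `X - Y`, and they feel it quadratically. -/
lemma eigDesc_gram_le_of_vanish (X Y : Matrix κ (Fin d) ℝ) {k j : ℕ}
    (L : Matrix (Fin k) (Fin d) ℝ) (hY : ∀ v, L *ᵥ v = 0 → Y *ᵥ v = 0)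
    (hkj : k < j) (hj : j ≤ d) : eigDesc (Xᵀ * X) j ≤ sqSum (X - Y) := by
  refine eigDesc_le_of_quadForm_le (posSemidef_gram X).isHermitian (Matrix.mulVecLin L) (by simpa)
    hj fun v hv => ?_
  have : X *ᵥ v = (X - Y) *ᵥ v := by rw [Matrix.sub_mulVec, hY v hv, sub_zero]
  rw [quadForm_gram, this]
  exact sum_sq_mulVec_le _ v

end Gram

/-! ### Frobenius norms -/

/-- The spectral norm bounds each column. -/
lemma sqSum_le_specNorm {a b : Type*} [Fintype a] [Fintype b] [DecidableEq b] (A : Matrix a b ℝ) :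
    sqSum A ≤ Fintype.card b * specNorm A ^ 2 := by
  rw [sqSum, Finset.sum_comm, ← nsmul_eq_mul, ← Finset.card_univ]
  refine Finset.sum_le_card_nsmul _ _ _ fun j _ => ?_
  have h := A.l2_opNorm_mulVec (EuclideanSpace.single j (1 : ℝ))
  rw [PiLp.norm_single, norm_one, mul_one] at h
  have h2 := pow_le_pow_left₀ (norm_nonneg _) h 2
  rw [EuclideanSpace.norm_sq_eq] at h2
  simpa [specNorm] using h2

/-! ### Davydov's covariance inequality -/

section Davydov

variable {Ω : Type*} {m₁ m₂ : MeasurableSpace Ω} [m0 : MeasurableSpace Ω] {μ : Measure Ω}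
  [IsProbabilityMeasure μ]

/-- Among the `m`-measurable variables bounded by one, the covariance with `η` is extremal at a
`±1`-valued one, the sign of `𝔼[η | m] - 𝔼[η]`. -/
lemma exists_sign_abs_cov_le (hm : m₁ ≤ m0) {ξ η : Ω → ℝ} (hξ : StronglyMeasurable[m₁] ξ)
    (hξ1 : ∀ ω, |ξ ω| ≤ 1) (hη : Integrable η μ) :
    ∃ s, MeasurableSet[m₁] s ∧ |∫ ω, ξ ω * η ω ∂μ - (∫ ω, ξ ω ∂μ) * ∫ ω, η ω ∂μ| ≤
      ∫ ω, (2 * s.indicator 1 ω - 1) * η ω ∂μ -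
        (∫ ω, (2 * s.indicator 1 ω - 1) ∂μ) * ∫ ω, η ω ∂μ := by
  set c := ∫ ω, η ω ∂μ with hc
  set Z : Ω → ℝ := fun ω => (μ[η | m₁]) ω - c with hZ
  have hZi : Integrable Z μ := integrable_condExp.sub (integrable_const c)
  have hZm : StronglyMeasurable[m₁] Z :=
    stronglyMeasurable_condExp.sub stronglyMeasurable_const
  have bdd : ∀ {ζ : Ω → ℝ} {f : Ω → ℝ}, StronglyMeasurable[m₁] ζ → (∀ ω, |ζ ω| ≤ 1) →
      Integrable f μ → Integrable (fun ω => ζ ω * f ω) μ := by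
    intro ζ f hζ hζ1 hf
    exact hf.bdd_mul (c := 1) (hζ.mono hm).aestronglyMeasurable (ae_of_all _ fun ω => hζ1 ω)
  have key : ∀ ζ : Ω → ℝ, StronglyMeasurable[m₁] ζ → (∀ ω, |ζ ω| ≤ 1) →
      ∫ ω, ζ ω * η ω ∂μ - (∫ ω, ζ ω ∂μ) * c = ∫ ω, ζ ω * Z ω ∂μ := by
    intro ζ hζ hζ1
    have h1 := condExp_stronglyMeasurable_mul_of_bound hm hζ hη 1 (ae_of_all μ hζ1)
    have h2 : ∫ ω, ζ ω * η ω ∂μ = ∫ ω, ζ ω * (μ[η | m₁]) ω ∂μ := by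
      rw [← integral_condExp hm]
      exact integral_congr_ae h1
    rw [h2, ← integral_mul_const, ← integral_sub (bdd hζ hζ1 integrable_condExp)]
    · exact integral_congr_ae (ae_of_all _ fun ω => by simp only [hZ]; ring)
    · exact bdd hζ hζ1 (integrable_const c)
  have hs : MeasurableSet[m₁] {ω | 0 ≤ Z ω} :=
    hZm.measurable measurableSet_Ici
  have hu : StronglyMeasurable[m₁] fun ω => 2 * ({ω | 0 ≤ Z ω}.indicator 1 ω : ℝ) - 1 :=
    ((StronglyMeasurable.indicator stronglyMeasurable_const hs).const_mul 2).sub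
      stronglyMeasurable_const
  have huabs : ∀ ω, (2 * ({ω | 0 ≤ Z ω}.indicator 1 ω : ℝ) - 1) * Z ω = |Z ω| := by
    intro ω
    by_cases h : 0 ≤ Z ω
    · rw [Set.indicator_of_mem (show ω ∈ {ω | 0 ≤ Z ω} from h), abs_of_nonneg h, Pi.one_apply]
      ring
    · rw [Set.indicator_of_notMem (show ω ∉ {ω | 0 ≤ Z ω} from h), abs_of_neg (not_le.1 h)]
      ring
  have hu1 : ∀ ω, |2 * ({ω | 0 ≤ Z ω}.indicator 1 ω : ℝ) - 1| ≤ 1 := by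
    intro ω
    by_cases h : ω ∈ {ω | 0 ≤ Z ω}
    · rw [Set.indicator_of_mem h]; norm_num
    · rw [Set.indicator_of_notMem h]; norm_num
  refine ⟨{ω | 0 ≤ Z ω}, hs, ?_⟩
  rw [key ξ hξ hξ1, key _ hu hu1]
  refine abs_integral_le_integral_abs.trans
    (integral_mono (bdd hξ hξ1 hZi).abs (bdd hu hu1 hZi) fun ω => ?_)
  simp only [huabs, abs_mul]
  exact mul_le_of_le_one_left (abs_nonneg _) (hξ1 ω)

/-- The covariance inequality for strongly mixing bounded variables. -/
lemma abs_cov_le_of_bounded (hm₁ : m₁ ≤ m0) (hm₂ : m₂ ≤ m0) {α : ℝ}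
    (hα : ∀ A B, MeasurableSet[m₁] A → MeasurableSet[m₂] B →
      |μ.real A * μ.real B - μ.real (A ∩ B)| ≤ α)
    {ξ η : Ω → ℝ} (hξ : StronglyMeasurable[m₁] ξ) (hη : StronglyMeasurable[m₂] η)
    (hξ1 : ∀ ω, |ξ ω| ≤ 1) (hη1 : ∀ ω, |η ω| ≤ 1) :
    |∫ ω, ξ ω * η ω ∂μ - (∫ ω, ξ ω ∂μ) * ∫ ω, η ω ∂μ| ≤ 4 * α := by
  have hηi : Integrable η μ := Integrable.of_bound (hη.mono hm₂).aestronglyMeasurable 1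
    (ae_of_all _ hη1)
  obtain ⟨s, hs, h1⟩ := exists_sign_abs_cov_le hm₁ hξ hξ1 hηi
  have ind : ∀ {r : Set Ω}, MeasurableSet[m0] r →
      Integrable (fun ω => (r.indicator 1 ω : ℝ)) μ := fun hr =>
    (integrable_const (1 : ℝ)).indicator hr
  have hui : Integrable (fun ω => 2 * (s.indicator 1 ω : ℝ) - 1) μ :=
    ((ind (hm₁ _ hs)).const_mul 2).sub (integrable_const _)
  obtain ⟨r, hr, h2⟩ := exists_sign_abs_cov_le hm₂ hη hη1 hui
  have hA : ∀ {r : Set Ω}, MeasurableSet[m0] r →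
      ∫ ω, (2 * (r.indicator 1 ω : ℝ) - 1) ∂μ = 2 * μ.real r - 1 := by
    intro r hr
    rw [integral_sub ((ind hr).const_mul 2) (integrable_const _), integral_const_mul,
      integral_indicator_one hr]
    simp
  have hB : ∫ ω, (2 * (r.indicator 1 ω : ℝ) - 1) * (2 * s.indicator 1 ω - 1) ∂μ =
      4 * μ.real (s ∩ r) - 2 * μ.real r - 2 * μ.real s + 1 := by
    have hsr : MeasurableSet[m0] (s ∩ r) := (hm₁ _ hs).inter (hm₂ _ hr)
    have : ∀ ω, (2 * (r.indicator 1 ω : ℝ) - 1) * (2 * s.indicator 1 ω - 1) =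
        4 * (s ∩ r).indicator 1 ω - 2 * r.indicator 1 ω - 2 * s.indicator 1 ω + 1 := by
      intro ω
      have : ((s ∩ r).indicator 1 ω : ℝ) = s.indicator 1 ω * r.indicator 1 ω := by
        rw [Set.inter_indicator_one]; rfl
      rw [this]; ring
    simp_rw [this]
    have i1 : Integrable (fun ω => 4 * ((s ∩ r).indicator 1 ω : ℝ)) μ := (ind hsr).const_mul 4
    have i2 : Integrable (fun ω => 2 * (r.indicator 1 ω : ℝ)) μ := (ind (hm₂ _ hr)).const_mul 2
    have i3 : Integrable (fun ω => 2 * (s.indicator 1 ω : ℝ)) μ := (ind (hm₁ _ hs)).const_mul 2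
    rw [integral_add (by exact (i1.sub i2).sub i3) (integrable_const _),
      integral_sub (by exact i1.sub i2) i3, integral_sub i1 i2,
      integral_const_mul, integral_const_mul, integral_const_mul,
      integral_indicator_one hsr, integral_indicator_one (hm₁ _ hs),
      integral_indicator_one (hm₂ _ hr)]
    simp
  rw [hA (hm₂ _ hr), hA (hm₁ _ hs), hB] at h2
  have h3 : ∫ ω, (2 * (s.indicator 1 ω : ℝ) - 1) * η ω ∂μ =
      ∫ ω, η ω * (2 * s.indicator 1 ω - 1) ∂μ := by
    simp_rw [mul_comm]
  rw [h3, mul_comm (∫ ω, (2 * (s.indicator 1 ω : ℝ) - 1) ∂μ), hA (hm₁ _ hs)] at h1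
  have h4 := (le_abs_self _).trans h2
  have h5 := (abs_le.1 (hα s r hs hr)).1
  linarith

lemma sq_le_one_add_rpow {γ : ℝ} (hγ : 2 ≤ γ) (x : ℝ) : x ^ 2 ≤ 1 + |x| ^ γ := by
  rw [← sq_abs]
  rcases le_total |x| 1 with h | h
  · have : 0 ≤ |x| ^ γ := by positivity
    nlinarith [abs_nonneg x]
  · have := Real.rpow_le_rpow_of_exponent_le h hγ
    rw [Real.rpow_two] at this
    linarith

/-- Cutting `ξ` and `η` off at level `c` leaves the bounded case and tails of order
`c ^ (2 - γ)`. -/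
lemma abs_cov_le_of_truncation (hm₁ : m₁ ≤ m0) (hm₂ : m₂ ≤ m0) {α γ K c : ℝ} (hγ : 2 < γ)
    (hc : 1 ≤ c)
    (hα : ∀ A B, MeasurableSet[m₁] A → MeasurableSet[m₂] B →
      |μ.real A * μ.real B - μ.real (A ∩ B)| ≤ α)
    {ξ η : Ω → ℝ} (hξ : StronglyMeasurable[m₁] ξ) (hη : StronglyMeasurable[m₂] η)
    (hξi : Integrable (fun ω => |ξ ω| ^ γ) μ) (hηi : Integrable (fun ω => |η ω| ^ γ) μ)
    (hξK : ∫ ω, |ξ ω| ^ γ ∂μ ≤ K) (hηK : ∫ ω, |η ω| ^ γ ∂μ ≤ K) :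
    |∫ ω, ξ ω * η ω ∂μ - (∫ ω, ξ ω ∂μ) * ∫ ω, η ω ∂μ| ≤
      4 * α * c ^ 2 + (2 * K + 2 * K * (1 + K)) * c ^ (2 - γ) := by
  have hc0 : 0 < c := by linarith
  have hK : 0 ≤ K := (integral_nonneg fun ω => by positivity).trans hξK
  let τ : ℝ → ℝ := fun x => if |x| ≤ c then x else 0
  have hτm : Measurable τ :=
    Measurable.ite (measurableSet_le continuous_abs.measurable measurable_const) measurable_id
      measurable_const
  have hτc : ∀ x, |τ x| ≤ c := by
    intro x; dsimp only [τ]; split_ifs with h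
    · exact h
    · simpa using hc0.le
  have hτle : ∀ x, |τ x| ≤ |x| := by
    intro x; dsimp only [τ]; split_ifs with h
    · exact le_rfl
    · simp
  have hone : ∀ x : ℝ, |x| ≤ 1 + |x| ^ γ := by
    intro x
    rcases le_total |x| 1 with h | h
    · have : 0 ≤ |x| ^ γ := by positivity
      linarith
    · have := Real.rpow_le_rpow_of_exponent_le h (show (1 : ℝ) ≤ γ by linarith)
      rw [Real.rpow_one] at this
      linarith
  have hpow : ∀ x : ℝ, c < x → ∀ q : ℝ, q < γ → x ^ q ≤ c ^ (q - γ) * x ^ γ := by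
    intro x hx q hq
    have hx0 : 0 < x := hc0.trans hx
    have h1 : x ^ q = x ^ (q - γ) * x ^ γ := by rw [← Real.rpow_add hx0]; ring_nf
    rw [h1]
    exact mul_le_mul_of_nonneg_right
      (Real.rpow_le_rpow_of_nonpos hc0 hx.le (by linarith)) (by positivity)
  have htail1 : ∀ x : ℝ, |x - τ x| ≤ c ^ (2 - γ) * |x| ^ γ := by
    intro x
    dsimp only [τ]; split_ifs with h
    · rw [sub_self, abs_zero]; positivity
    · rw [sub_zero]
      have h1 := hpow |x| (not_le.1 h) 1 (by linarith)
      rw [Real.rpow_one] at h1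
      refine h1.trans (mul_le_mul_of_nonneg_right ?_ (by positivity))
      exact Real.rpow_le_rpow_of_exponent_le hc (by linarith)
  have htail2 : ∀ x y : ℝ, |x * y - τ x * τ y| ≤ c ^ (2 - γ) * (|x| ^ γ + |y| ^ γ) := by
    intro x y
    have hbig : ∀ x y : ℝ, c < |x| → |y| ≤ |x| → |x * y| ≤ c ^ (2 - γ) * (|x| ^ γ + |y| ^ γ) := by
      intro x y hx hyx
      have h1 := hpow |x| hx 2 hγ
      rw [Real.rpow_two] at h1
      have h2 : |x * y| ≤ |x| ^ 2 := by
        rw [abs_mul, sq]; exact mul_le_mul_of_nonneg_left hyx (abs_nonneg _)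
      have h3 : 0 ≤ c ^ (2 - γ) * |y| ^ γ := by positivity
      rw [mul_add]; linarith
    by_cases hx : |x| ≤ c <;> by_cases hy : |y| ≤ c
    · simp only [τ, hx, hy, if_true, sub_self, abs_zero]; positivity
    · simp only [τ, hy, if_false, mul_zero, sub_zero]
      rw [mul_comm, add_comm]
      exact hbig y x (not_le.1 hy) (hx.trans (not_le.1 hy).le)
    · simp only [τ, hx, if_false, zero_mul, sub_zero]
      exact hbig x y (not_le.1 hx) (hy.trans (not_le.1 hx).le)
    · simp only [τ, hx, if_false, zero_mul, sub_zero]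
      rcases le_total |y| |x| with h | h
      · exact hbig x y (not_le.1 hx) h
      · rw [mul_comm, add_comm]; exact hbig y x (not_le.1 hy) h
  have hξm := (hξ.mono hm₁).measurable
  have hηm := (hη.mono hm₂).measurable
  have int1 : ∀ {ζ : Ω → ℝ}, Measurable ζ → Integrable (fun ω => |ζ ω| ^ γ) μ →
      Integrable ζ μ := fun hζ hi =>
    ((integrable_const (1 : ℝ)).add hi).mono' hζ.aestronglyMeasurable
      (ae_of_all _ fun ω => hone _)
  have lp : ∀ {ζ : Ω → ℝ}, Measurable ζ → Integrable (fun ω => |ζ ω| ^ γ) μ →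
      MemLp ζ 2 μ := fun hζ hi =>
    (memLp_two_iff_integrable_sq hζ.aestronglyMeasurable).2 <|
      ((integrable_const (1 : ℝ)).add hi).mono' (hζ.pow_const 2).aestronglyMeasurable
        (ae_of_all _ fun ω => by
          rw [Real.norm_of_nonneg (sq_nonneg _)]; exact sq_le_one_add_rpow hγ.le _)
  have intτ : ∀ {ζ : Ω → ℝ}, Measurable ζ → Integrable (fun ω => τ (ζ ω)) μ := fun hζ =>
    Integrable.of_bound (hτm.comp hζ).aestronglyMeasurable c (ae_of_all _ fun ω => hτc _)
  have hmean : ∀ {ζ : Ω → ℝ}, Measurable ζ → Integrable (fun ω => |ζ ω| ^ γ) μ →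
      ∫ ω, |ζ ω| ^ γ ∂μ ≤ K → ∫ ω, |ζ ω| ∂μ ≤ 1 + K := by
    intro ζ hζ hi hK'
    have := integral_mono (int1 hζ hi).abs ((integrable_const (1 : ℝ)).add hi) fun ω => hone (ζ ω)
    simp only [Pi.add_apply] at this
    rw [integral_add (integrable_const _) hi] at this
    simp only [integral_const, probReal_univ, smul_eq_mul, mul_one] at this
    linarith
  have hdiff : ∀ {ζ : Ω → ℝ}, Measurable ζ → Integrable (fun ω => |ζ ω| ^ γ) μ →
      ∫ ω, |ζ ω| ^ γ ∂μ ≤ K → |∫ ω, ζ ω ∂μ - ∫ ω, τ (ζ ω) ∂μ| ≤ c ^ (2 - γ) * K := by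
    intro ζ hζ hi hK'
    rw [← integral_sub (int1 hζ hi) (intτ hζ)]
    refine abs_integral_le_integral_abs.trans ?_
    refine (integral_mono ((int1 hζ hi).sub (intτ hζ)).abs (hi.const_mul (c ^ (2 - γ)))
      fun ω => htail1 _).trans ?_
    rw [integral_const_mul]
    exact mul_le_mul_of_nonneg_left hK' (by positivity)
  -- The bounded case applies to the truncated variables after scaling them to `[-1, 1]`.
  have hbd := abs_cov_le_of_bounded hm₁ hm₂ hα (ξ := fun ω => c⁻¹ * τ (ξ ω))
    (η := fun ω => c⁻¹ * τ (η ω))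
    ((hτm.comp hξ.measurable).stronglyMeasurable.const_mul _)
    ((hτm.comp hη.measurable).stronglyMeasurable.const_mul _)
    (fun ω => by
      rw [abs_mul, abs_of_pos (inv_pos.2 hc0), inv_mul_le_iff₀ hc0, mul_one]; exact hτc _)
    (fun ω => by
      rw [abs_mul, abs_of_pos (inv_pos.2 hc0), inv_mul_le_iff₀ hc0, mul_one]; exact hτc _)
  have hbd' : |∫ ω, τ (ξ ω) * τ (η ω) ∂μ - (∫ ω, τ (ξ ω) ∂μ) * ∫ ω, τ (η ω) ∂μ| ≤
      4 * α * c ^ 2 := by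
    have h1 : ∀ ω, c⁻¹ * τ (ξ ω) * (c⁻¹ * τ (η ω)) = (c ^ 2)⁻¹ * (τ (ξ ω) * τ (η ω)) := by
      intro ω; rw [sq, mul_inv]; ring
    simp_rw [h1] at hbd
    rw [integral_const_mul, integral_const_mul, integral_const_mul] at hbd
    have h2 : (c ^ 2)⁻¹ * ∫ ω, τ (ξ ω) * τ (η ω) ∂μ -
        (c⁻¹ * ∫ ω, τ (ξ ω) ∂μ) * (c⁻¹ * ∫ ω, τ (η ω) ∂μ) = (c ^ 2)⁻¹ *
        (∫ ω, τ (ξ ω) * τ (η ω) ∂μ - (∫ ω, τ (ξ ω) ∂μ) * ∫ ω, τ (η ω) ∂μ) := by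
      rw [sq, mul_inv]; ring
    rw [h2, abs_mul, abs_of_pos (by positivity), inv_mul_le_iff₀ (by positivity)] at hbd
    linarith
  have hprod : |∫ ω, ξ ω * η ω ∂μ - ∫ ω, τ (ξ ω) * τ (η ω) ∂μ| ≤ c ^ (2 - γ) * (K + K) := by
    have i1 : Integrable (fun ω => ξ ω * η ω) μ := (lp hξm hξi).integrable_mul (lp hηm hηi)
    have i2 : Integrable (fun ω => τ (ξ ω) * τ (η ω)) μ :=
      (intτ hηm).bdd_mul (c := c) (hτm.comp hξm).aestronglyMeasurable
        (ae_of_all _ fun ω => hτc _)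
    rw [← integral_sub i1 i2]
    refine abs_integral_le_integral_abs.trans ?_
    refine (integral_mono (i1.sub i2).abs ((hξi.add hηi).const_mul (c ^ (2 - γ)))
      fun ω => htail2 _ _).trans ?_
    rw [integral_const_mul]
    simp only [Pi.add_apply]
    rw [integral_add hξi hηi]
    exact mul_le_mul_of_nonneg_left (add_le_add hξK hηK) (by positivity)
  have hmη : |∫ ω, η ω ∂μ| ≤ 1 + K :=
    abs_integral_le_integral_abs.trans (hmean hηm hηi hηK)
  have hmξ : |∫ ω, τ (ξ ω) ∂μ| ≤ 1 + K :=
    (abs_integral_le_integral_abs.trans (integral_mono (intτ hξm).abs (int1 hξm hξi).abs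
      fun ω => hτle _)).trans (hmean hξm hξi hξK)
  have hd1 := hdiff hξm hξi hξK
  have hd2 := hdiff hηm hηi hηK
  set a := ∫ ω, ξ ω * η ω ∂μ
  set a' := ∫ ω, τ (ξ ω) * τ (η ω) ∂μ
  set x := ∫ ω, ξ ω ∂μ
  set x' := ∫ ω, τ (ξ ω) ∂μ
  set y := ∫ ω, η ω ∂μ
  set y' := ∫ ω, τ (η ω) ∂μ
  have e : a - x * y = (a' - x' * y') + (a - a') - ((x - x') * y + x' * (y - y')) := by ring
  have hp1 : |(x - x') * y| ≤ c ^ (2 - γ) * K * (1 + K) := by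
    rw [abs_mul]; exact mul_le_mul hd1 hmη (abs_nonneg _) (by positivity)
  have hp2 : |x' * (y - y')| ≤ (1 + K) * (c ^ (2 - γ) * K) := by
    rw [abs_mul]; exact mul_le_mul hmξ hd2 (abs_nonneg _) (by positivity)
  rw [e]
  calc _ ≤ |a' - x' * y'| + |a - a'| + (|(x - x') * y| + |x' * (y - y')|) :=
        (abs_sub _ _).trans (add_le_add (abs_add_le _ _) (abs_add_le _ _))
    _ ≤ 4 * α * c ^ 2 + c ^ (2 - γ) * (K + K) +
        (c ^ (2 - γ) * K * (1 + K) + (1 + K) * (c ^ (2 - γ) * K)) := by gcongr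
    _ = _ := by ring

/-- **Davydov's inequality**, for variables with a common bound on their moments of order `γ`. -/
lemma abs_cov_le_of_mixing (hm₁ : m₁ ≤ m0) (hm₂ : m₂ ≤ m0) {α γ K : ℝ} (hγ : 2 < γ)
    (hα0 : 0 ≤ α) (hα1 : α ≤ 1)
    (hα : ∀ A B, MeasurableSet[m₁] A → MeasurableSet[m₂] B →
      |μ.real A * μ.real B - μ.real (A ∩ B)| ≤ α)
    {ξ η : Ω → ℝ} (hξ : StronglyMeasurable[m₁] ξ) (hη : StronglyMeasurable[m₂] η)
    (hξi : Integrable (fun ω => |ξ ω| ^ γ) μ) (hηi : Integrable (fun ω => |η ω| ^ γ) μ)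
    (hξK : ∫ ω, |ξ ω| ^ γ ∂μ ≤ K) (hηK : ∫ ω, |η ω| ^ γ ∂μ ≤ K) :
    |∫ ω, ξ ω * η ω ∂μ - (∫ ω, ξ ω ∂μ) * ∫ ω, η ω ∂μ| ≤
      (4 + (2 * K + 2 * K * (1 + K))) * α ^ (1 - 2 / γ) := by
  have h := fun c hc => abs_cov_le_of_truncation hm₁ hm₂ (c := c) hγ hc hα hξ hη hξi hηi hξK hηK
  have hγ0 : 0 < γ := by linarith
  rcases hα0.eq_or_lt with h0 | h0
  · -- For `α = 0` no level balances the two terms: let the cut-off level tend to infinity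
    have hne : 1 - 2 / γ ≠ 0 := by
      have : 2 / γ < 1 := by rw [div_lt_one hγ0]; exact hγ
      linarith
    rw [← h0, Real.zero_rpow hne, mul_zero]
    have ht : Tendsto (fun c : ℝ => 4 * α * c ^ 2 + (2 * K + 2 * K * (1 + K)) * c ^ (2 - γ)) atTop
        (𝓝 0) := by
      have h1 := (tendsto_rpow_neg_atTop (show 0 < γ - 2 by linarith)).const_mul
        (2 * K + 2 * K * (1 + K))
      rw [mul_zero] at h1
      refine h1.congr fun c => ?_
      rw [← h0, neg_sub]; ring
    exact ge_of_tendsto ht ((eventually_ge_atTop 1).mono fun c hc => h c hc)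
  · -- The two terms balance at the level `α ^ (-1 / γ)`
    have hc : 1 ≤ α ^ (-(1 / γ)) :=
      Real.one_le_rpow_of_pos_of_le_one_of_nonpos h0 hα1 (by
        have : 0 < 1 / γ := by positivity
        linarith)
    have h1 := h _ hc
    have e1 : α * (α ^ (-(1 / γ))) ^ 2 = α ^ (1 - 2 / γ) := by
      rw [← Real.rpow_two, ← Real.rpow_mul hα0]
      nth_rewrite 1 [← Real.rpow_one α]
      rw [← Real.rpow_add h0]
      congr 1; ring
    have e2 : (α ^ (-(1 / γ))) ^ (2 - γ) = α ^ (1 - 2 / γ) := by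
      rw [← Real.rpow_mul hα0]
      congr 1; field_simp; ring
    rw [mul_assoc, e1, e2, ← add_mul] at h1
    exact h1

end Davydov

/-! ### Second moments of time averages -/

section Averages

variable {Ω : Type*} [MeasurableSpace Ω] {μ : Measure Ω}

/-- The time average `T⁻¹ ∑_{t=1}^T Z_t`. -/
noncomputable def timeAvg (T : ℕ) (Z : ℤ → Ω → ℝ) (ω : Ω) : ℝ :=
  (T : ℝ)⁻¹ * ∑ t ∈ Finset.Icc (1 : ℤ) T, Z t ω

lemma sum_lag_le {c : ℕ → ℝ} (hc0 : ∀ k, 0 ≤ c k) (hc : Summable c) (s : ℤ) (I : Finset ℤ) :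
    ∑ t ∈ I, c (s - t).natAbs ≤ 2 * ∑' k, c k := by
  have key : ∀ J : Finset ℤ, Set.InjOn (fun t => (s - t).natAbs) J →
      ∑ t ∈ J, c (s - t).natAbs ≤ ∑' k, c k := by
    intro J hJ
    rw [← Finset.sum_image (f := c) (g := fun t : ℤ => (s - t).natAbs) hJ]
    exact hc.sum_le_tsum _ fun k _ => hc0 k
  rw [← Finset.sum_filter_add_sum_filter_not I (fun t => t ≤ s), two_mul]
  refine add_le_add (key _ ?_) (key _ ?_)
  all_goals
    intro x hx y hy hxy
    simp only [Finset.coe_filter, Set.mem_ofPred_eq] at hx hy hxy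
    omega

/-- Summable correlations make the second moment of a time average of order `T⁻¹`. -/
lemma integral_timeAvg_sq_le {c : ℕ → ℝ} (hc0 : ∀ k, 0 ≤ c k) (hc : Summable c) {T : ℕ}
    {Z : ℤ → Ω → ℝ} (hZ : ∀ t ∈ Set.Icc (1 : ℤ) T, MemLp (Z t) 2 μ)
    (hcov : ∀ s ∈ Set.Icc (1 : ℤ) T, ∀ t ∈ Set.Icc (1 : ℤ) T,
      |∫ ω, Z s ω * Z t ω ∂μ| ≤ c (s - t).natAbs) :
    ∫ ω, timeAvg T Z ω ^ 2 ∂μ ≤ 2 * (∑' k, c k) * (T : ℝ)⁻¹ := by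
  have h1 : ∀ ω, timeAvg T Z ω ^ 2 = (T : ℝ)⁻¹ ^ 2 *
      ∑ s ∈ Finset.Icc (1 : ℤ) T, ∑ t ∈ Finset.Icc (1 : ℤ) T, Z s ω * Z t ω := by
    intro ω; rw [timeAvg, mul_pow, sq (∑ t ∈ _, _), Finset.sum_mul_sum]
  have hi : ∀ s ∈ Finset.Icc (1 : ℤ) T, ∀ t ∈ Finset.Icc (1 : ℤ) T,
      Integrable (fun ω => Z s ω * Z t ω) μ := fun s hs t ht =>
    (hZ s (Finset.mem_Icc.1 hs)).integrable_mul (hZ t (Finset.mem_Icc.1 ht))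
  simp_rw [h1]
  rw [integral_const_mul, integral_finsetSum _ fun s hs => integrable_finsetSum _ (hi s hs)]
  have h2 : ∀ s ∈ Finset.Icc (1 : ℤ) T,
      ∫ ω, ∑ t ∈ Finset.Icc (1 : ℤ) T, Z s ω * Z t ω ∂μ ≤ 2 * ∑' k, c k := by
    intro s hs
    rw [integral_finsetSum _ (hi s hs)]
    exact (Finset.sum_le_sum fun t ht => (le_abs_self _).trans
      (hcov s (Finset.mem_Icc.1 hs) t (Finset.mem_Icc.1 ht))).trans (sum_lag_le hc0 hc s _)
  have h3 := Finset.sum_le_card_nsmul _ _ _ h2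
  rw [Int.card_Icc, nsmul_eq_mul, show ((T : ℤ) + 1 - 1).toNat = T by simp] at h3
  refine (mul_le_mul_of_nonneg_left h3 (by positivity)).trans ?_
  rcases Nat.eq_zero_or_pos T with h0 | h0
  · simp [h0]
  · have : (T : ℝ) ≠ 0 := by positivity
    exact le_of_eq (by field_simp)

lemma integral_timeAvg_sq_le_of_orthogonal {K : ℝ} (hK : 0 ≤ K) {T : ℕ}
    {Z : ℤ → Ω → ℝ} (hZ : ∀ t ∈ Set.Icc (1 : ℤ) T, MemLp (Z t) 2 μ)
    (hsq : ∀ t ∈ Set.Icc (1 : ℤ) T, ∫ ω, Z t ω ^ 2 ∂μ ≤ K)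
    (horth : ∀ s ∈ Set.Icc (1 : ℤ) T, ∀ t ∈ Set.Icc (1 : ℤ) T, s ≠ t →
      ∫ ω, Z s ω * Z t ω ∂μ = 0) :
    ∫ ω, timeAvg T Z ω ^ 2 ∂μ ≤ 2 * K * (T : ℝ)⁻¹ := by
  have h := integral_timeAvg_sq_le (μ := μ) (c := fun k => if k = 0 then K else 0)
    (fun k => by split_ifs <;> simp [hK])
    (summable_of_ne_finset_zero (s := {0}) fun k hk =>
      if_neg (by simpa using hk)) hZ ?_
  · rwa [tsum_ite_eq] at h
  · intro s hs t ht
    by_cases hst : s = t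
    · subst hst
      simp only [sub_self, Int.natAbs_zero, if_true, ← sq]
      rw [abs_of_nonneg (integral_nonneg fun ω => sq_nonneg _)]
      exact hsq s hs
    · rw [horth s hs t ht hst, abs_zero]
      split_ifs <;> simp [hK]

lemma memLp_timeAvg {T : ℕ} {Z : ℤ → Ω → ℝ} (hZ : ∀ t ∈ Set.Icc (1 : ℤ) T, MemLp (Z t) 2 μ) :
    MemLp (timeAvg T Z) 2 μ :=
  (memLp_finsetSum _ fun t ht => hZ t (Finset.mem_Icc.1 ht)).const_mul _

/-! ### Strong mixing -/

lemma alphaMix_bounds [IsProbabilityMeasure μ] {ι : Type*} (V : ℤ → Ω → ι → ℝ) (k : ℕ) :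
    0 ≤ alphaMix μ V k ∧ alphaMix μ V k ≤ 1 ∧
      ∀ (i : ℤ) (A B : Set Ω), MeasurableSet[sigmaGen V (Set.Iic i)] A →
        MeasurableSet[sigmaGen V (Set.Ici (i + k))] B →
        |μ.real A * μ.real B - μ.real (A ∩ B)| ≤ alphaMix μ V k := by
  have hle : ∀ A B : Set Ω, |μ.real A * μ.real B - μ.real (A ∩ B)| ≤ 1 := by
    intro A B
    have h1 : μ.real A ≤ 1 := measureReal_le_one
    have h2 : μ.real B ≤ 1 := measureReal_le_one
    have h3 : μ.real (A ∩ B) ≤ 1 := measureReal_le_one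
    have h4 : 0 ≤ μ.real A := measureReal_nonneg
    have h5 : 0 ≤ μ.real B := measureReal_nonneg
    have h6 : 0 ≤ μ.real (A ∩ B) := measureReal_nonneg
    rw [abs_le]
    constructor <;> nlinarith
  refine ⟨?_, ?_, ?_⟩
  · refine Real.sSup_nonneg ?_
    rintro x ⟨i, A, B, -, -, rfl⟩
    exact abs_nonneg _
  · refine Real.sSup_le ?_ zero_le_one
    rintro x ⟨i, A, B, -, -, rfl⟩
    exact hle A B
  · intro i A B hA hB
    refine le_csSup ⟨1, ?_⟩ ⟨i, A, B, hA, hB, rfl⟩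
    rintro x ⟨i, A, B, -, -, rfl⟩
    exact hle A B

/-- Centered time averages of an instantaneous function of a mixing process with bounded moments
have second moments of order `T⁻¹`. -/
lemma exists_integral_timeAvg_sq_le_of_mixing [IsProbabilityMeasure μ] {ι : Type*}
    {V : ℤ → Ω → ι → ℝ} (hV : ∀ t, Measurable (V t)) {γ : ℝ} (hγ : 2 < γ)
    (hsum : Summable fun k : ℕ => alphaMix μ V (k + 1) ^ (1 - 2 / γ)) {K : ℝ} (hK : 0 ≤ K) :
    ∃ C : ℝ, 0 ≤ C ∧ ∀ g : (ι → ℝ) → ℝ, Measurable g →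
      (∀ t, 1 ≤ t → Integrable (fun ω => |g (V t ω)| ^ γ) μ) →
      (∀ t, 1 ≤ t → ∫ ω, |g (V t ω)| ^ γ ∂μ ≤ K) →
      (∀ t, 1 ≤ t → MemLp (fun ω => g (V t ω)) 2 μ) →
      ∀ T : ℕ, ∫ ω, timeAvg T (fun t ω => g (V t ω) - ∫ ω', g (V t ω') ∂μ) ω ^ 2 ∂μ
        ≤ C * (T : ℝ)⁻¹ := by
  set B : ℝ := 4 + (2 * K + 2 * K * (1 + K)) with hB
  have hB0 : 0 ≤ B := by positivity
  -- `c 0` bounds the variances, `c (k + 1)` is Davydov's bound at lag `k + 1`.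
  let c : ℕ → ℝ := fun k => Nat.casesOn k (1 + K) fun k => B * alphaMix μ V (k + 1) ^ (1 - 2 / γ)
  have hc0 : ∀ k, 0 ≤ c k := by
    intro k
    cases k with
    | zero => exact add_nonneg zero_le_one hK
    | succ k => exact mul_nonneg hB0 (Real.rpow_nonneg (alphaMix_bounds V _).1 _)
  have hcs : Summable c := by
    rw [← summable_nat_add_iff 1]
    exact hsum.mul_left B
  refine ⟨2 * ∑' k, c k, mul_nonneg zero_le_two (tsum_nonneg hc0), ?_⟩
  intro g hg hi hiK hL T
  have hL' : ∀ t, 1 ≤ t → MemLp (fun ω => g (V t ω) - ∫ ω', g (V t ω') ∂μ) 2 μ :=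
    fun t ht => (hL t ht).sub (memLp_const _)
  refine integral_timeAvg_sq_le hc0 hcs (fun t ht => hL' t ht.1) ?_
  have hsg : ∀ (t : ℤ) (S : Set ℤ), t ∈ S →
      StronglyMeasurable[sigmaGen V S] fun ω => g (V t ω) := by
    intro t S ht
    have h1 : Measurable[sigmaGen V S] (V t) := by
      rw [measurable_iff_comap_le]
      exact le_iSup₂ (f := fun t (_ : t ∈ S) => MeasurableSpace.comap (V t) inferInstance) t ht
    exact (hg.comp h1).stronglyMeasurable
  have hle : ∀ S, sigmaGen V S ≤ ‹MeasurableSpace Ω› := fun S =>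
    iSup₂_le fun t _ => (hV t).comap_le
  have hcoveq : ∀ s t, 1 ≤ s → 1 ≤ t →
      ∫ ω, (g (V s ω) - ∫ ω', g (V s ω') ∂μ) * (g (V t ω) - ∫ ω', g (V t ω') ∂μ) ∂μ =
      ∫ ω, g (V s ω) * g (V t ω) ∂μ - (∫ ω, g (V s ω) ∂μ) * ∫ ω, g (V t ω) ∂μ :=
    fun s t hs ht => covariance_eq_sub (hL s hs) (hL t ht)
  -- By symmetry only positive lags, with the earlier time first, need Davydov's inequality.
  have hlt : ∀ s t, 1 ≤ s → s < t →
      |∫ ω, g (V s ω) * g (V t ω) ∂μ - (∫ ω, g (V s ω) ∂μ) * ∫ ω, g (V t ω) ∂μ| ≤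
        c (s - t).natAbs := by
    intro s t hs hst
    obtain ⟨k, hk⟩ : ∃ k : ℕ, t = s + (k + 1 : ℕ) := ⟨(t - s - 1).toNat, by omega⟩
    have hk' : (s - t).natAbs = k + 1 := by omega
    rw [hk']
    obtain ⟨h0, h1, h2⟩ := alphaMix_bounds (μ := μ) V (k + 1)
    exact abs_cov_le_of_mixing (hle _) (hle _) hγ h0 h1 (h2 s) (hsg s _ Set.self_mem_Iic)
      (hsg t _ (by rw [hk]; exact Set.self_mem_Ici)) (hi s hs) (hi t (by omega)) (hiK s hs)
      (hiK t (by omega))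
  rintro s ⟨hs, -⟩ t ⟨ht, -⟩
  rw [hcoveq s t hs ht]
  rcases lt_trichotomy s t with h | h | h
  · exact hlt s t hs h
  · subst h
    rw [← hcoveq s s hs hs, sub_self]
    change _ ≤ 1 + K
    have h1 := integral_mono (hL s hs).integrable_sq ((integrable_const (1 : ℝ)).add (hi s hs))
      fun ω => sq_le_one_add_rpow hγ.le (g (V s ω))
    simp only [Pi.add_apply] at h1
    rw [integral_add (integrable_const _) (hi s hs)] at h1
    simp only [integral_const, probReal_univ, smul_eq_mul, mul_one] at h1
    rw [hcoveq s s hs hs, abs_of_nonneg]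
    · simp only [← sq]
      nlinarith [sq_nonneg (∫ ω, g (V s ω) ∂μ), hiK s hs]
    · rw [← hcoveq s s hs hs]
      exact integral_nonneg fun ω => mul_self_nonneg _
  · have := hlt t s ht h
    rw [← Int.natAbs_neg, neg_sub] at this
    simpa only [mul_comm] using this

end Averages

/-! ### Algebra of the Frobenius norm -/

section SqSum

variable {ι κ ν : Type*} [Fintype ι] [Fintype κ] [Fintype ν]

lemma sqSum_transpose (A : Matrix ι κ ℝ) : sqSum Aᵀ = sqSum A := Finset.sum_comm

lemma sqSum_mul_le (A : Matrix ι κ ℝ) (B : Matrix κ ν ℝ) : sqSum (A * B) ≤ sqSum A * sqSum B := by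
  rw [← sqSum_transpose B, sqSum, sqSum, sqSum, Finset.sum_mul_sum]
  refine Finset.sum_le_sum fun i _ => Finset.sum_le_sum fun j _ => ?_
  simpa only [Matrix.mul_apply, Matrix.transpose_apply] using
    Finset.sum_mul_sq_le_sq_mul_sq Finset.univ (fun k => A i k) (fun k => B k j)

lemma sqSum_mul_mul_transpose_le {ρ : Type*} [Fintype ρ] (A : Matrix ι κ ℝ) (B : Matrix κ ν ℝ)
    (C : Matrix ρ ν ℝ) : sqSum (A * B * Cᵀ) ≤ sqSum A * sqSum B * sqSum C := by
  refine (sqSum_mul_le _ _).trans ?_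
  rw [sqSum_transpose]
  exact mul_le_mul_of_nonneg_right (sqSum_mul_le _ _) (sqSum_nonneg _)

lemma sqSum_add_le (A B C D : Matrix ι κ ℝ) :
    sqSum (A + B + C + D) ≤ 4 * (sqSum A + sqSum B + sqSum C + sqSum D) := by
  simp only [sqSum, ← Finset.sum_add_distrib, Finset.mul_sum, Matrix.add_apply]
  refine Finset.sum_le_sum fun i _ => Finset.sum_le_sum fun j _ => ?_
  nlinarith [sq_nonneg (A i j - B i j), sq_nonneg (A i j - C i j), sq_nonneg (A i j - D i j),
    sq_nonneg (B i j - C i j), sq_nonneg (B i j - D i j), sq_nonneg (C i j - D i j)]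

lemma sqSum_fromCols (A : Matrix ι κ ℝ) (B : Matrix ι ν ℝ) :
    sqSum (Matrix.fromCols A B) = sqSum A + sqSum B := by
  simp [sqSum, Fintype.sum_sum_type, Finset.sum_add_distrib]

lemma sqSum_le_of_abs_le {A : Matrix ι κ ℝ} {K : ℝ} (hA : ∀ i j, |A i j| ≤ K) :
    sqSum A ≤ Fintype.card ι * Fintype.card κ * K ^ 2 := by
  have h : ∀ i j, A i j ^ 2 ≤ K ^ 2 := fun i j => by
    rw [← sq_abs]; exact pow_le_pow_left₀ (abs_nonneg _) (hA i j) 2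
  refine (Finset.sum_le_sum fun i _ => Finset.sum_le_sum fun j _ => h i j).trans ?_
  simp [mul_assoc]

lemma sqSum_kronecker {a b c d : Type*} [Fintype a] [Fintype b] [Fintype c] [Fintype d]
    (A : Matrix a b ℝ) (B : Matrix c d ℝ) :
    sqSum (Matrix.of fun (x : a × c) (s : d × b) => A x.1 s.2 * B x.2 s.1) =
      sqSum A * sqSum B := by
  simp only [sqSum, Matrix.of_apply, mul_pow, Fintype.sum_prod_type]
  rw [Finset.sum_mul_sum]
  refine Finset.sum_congr rfl fun i _ => Finset.sum_congr rfl fun j _ => ?_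
  rw [Finset.sum_comm, Finset.sum_mul_sum]

end SqSum

/-! ### `W` and `Ŵ` as Gram matrices -/

section Stack

variable {M : ℕ} {a b : Fin M → ℕ} {m : Fin M}

/-- The transposes of all the matrices `O i j₁ j₂`, `i ≠ m`, stacked on top of each other. -/
def stack (O : ∀ i, Fin (b m) → Fin (b i) → Matrix (Fin (a m)) (Fin (a i)) ℝ) :
    Matrix (Σ i : {i : Fin M // i ≠ m}, Fin (b m) × Fin (b i) × Fin (a i)) (Fin (a m)) ℝ :=
  Matrix.of fun k x => O k.1 k.2.1 k.2.2.1 x k.2.2.2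

lemma sum_mul_transpose_eq_gram
    (O : ∀ i, Fin (b m) → Fin (b i) → Matrix (Fin (a m)) (Fin (a i)) ℝ) :
    ∑ i ∈ Finset.univ.erase m, ∑ j₁, ∑ j₂, O i j₁ j₂ * (O i j₁ j₂)ᵀ = (stack O)ᵀ * stack O := by
  ext x y
  rw [Finset.sum_subtype (p := fun i => i ≠ m) (F := inferInstance) _ (by simp)]
  simp only [Matrix.sum_apply, Matrix.mul_apply, Matrix.transpose_apply, stack, Matrix.of_apply,
    Fintype.sum_sigma, Fintype.sum_prod_type]

lemma sqSum_stack (O : ∀ i, Fin (b m) → Fin (b i) → Matrix (Fin (a m)) (Fin (a i)) ℝ) :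
    sqSum (stack O) = ∑ i : {i : Fin M // i ≠ m},
      sqSum (Matrix.of fun (x : Fin (a m) × Fin (b m)) (y : Fin (a i) × Fin (b i)) =>
        O i x.2 y.2 x.1 y.1) := by
  simp only [sqSum, Fintype.sum_sigma, Fintype.sum_prod_type, stack, Matrix.of_apply]
  refine Finset.sum_congr rfl fun i _ => ?_
  calc _ = ∑ j₁, ∑ j₂, ∑ x, ∑ y, O i j₁ j₂ x y ^ 2 :=
        Finset.sum_congr rfl fun _ _ => Finset.sum_congr rfl fun _ _ => Finset.sum_comm
    _ = ∑ j₁, ∑ x, ∑ j₂, ∑ y, O i j₁ j₂ x y ^ 2 :=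
        Finset.sum_congr rfl fun _ _ => Finset.sum_comm
    _ = ∑ x, ∑ j₁, ∑ j₂, ∑ y, O i j₁ j₂ x y ^ 2 := Finset.sum_comm
    _ = _ := Finset.sum_congr rfl fun _ _ => Finset.sum_congr rfl fun _ _ => Finset.sum_comm

lemma stack_sub (O O' : ∀ i, Fin (b m) → Fin (b i) → Matrix (Fin (a m)) (Fin (a i)) ℝ) :
    stack O - stack O' = stack fun i j₁ j₂ => O i j₁ j₂ - O' i j₁ j₂ := rfl

end Stack

/-! ### The model in vector form -/

section Model

variable {Ω : Type*} {M k₁ k₂ : ℕ} {r₁ r₂ : Fin M → ℕ}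

/-- `(vec G_t, vec F_{mt})`, the factors that enter the observations of group `m`. -/
def FactorProcess.vecs (Φ : FactorProcess Ω M k₁ k₂ r₁ r₂) (m : Fin M) (t : ℤ) (ω : Ω) :
    (Fin k₂ × Fin k₁) ⊕ (Fin (r₂ m) × Fin (r₁ m)) → ℝ :=
  Sum.elim (Φ.G t ω).vec (Φ.F m t ω).vec

/-- The position in `Φ.joint` of the components of `Φ.vecs m`. -/
def jointIndex (m : Fin M) : (Fin k₂ × Fin k₁) ⊕ (Fin (r₂ m) × Fin (r₁ m)) →
    (Fin k₂ × Fin k₁) ⊕ (Σ m : Fin M, Fin (r₂ m) × Fin (r₁ m)) :=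
  Sum.map id fun s => ⟨m, s⟩

lemma joint_jointIndex (Φ : FactorProcess Ω M k₁ k₂ r₁ r₂) (m : Fin M) (t : ℤ) (ω : Ω) (s) :
    Φ.joint t ω (jointIndex m s) = Φ.vecs m t ω s := by
  rcases s with s | s <;> rfl

namespace Panel

variable (P : Panel Ω M k₁ k₂ r₁ r₂) (Φ : FactorProcess Ω M k₁ k₂ r₁ r₂)

/-- The observations of group `m` as a vector indexed by (row, column). -/
def vecX (m : Fin M) (t : ℤ) (ω : Ω) : Fin (P.N m) × Fin P.p → ℝ :=
  fun x => P.X Φ m t ω x.1 x.2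

/-- The errors of group `m` as a vector indexed by (row, column). -/
def vecE (m : Fin M) (t : ℤ) (ω : Ω) : Fin (P.N m) × Fin P.p → ℝ :=
  fun x => P.E m t ω x.1 x.2

/-- The Kronecker product of `R_m` and `C_m`, indexed to act on `vec G_t`. -/
def globalLoading (m : Fin M) : Matrix (Fin (P.N m) × Fin P.p) (Fin k₂ × Fin k₁) ℝ :=
  Matrix.of fun x s => P.R m x.1 s.2 * P.C m x.2 s.1

/-- The Kronecker product of `Γ_m` and `Λ_m`, indexed to act on `vec F_{mt}`. -/
def localLoading (m : Fin M) : Matrix (Fin (P.N m) × Fin P.p) (Fin (r₂ m) × Fin (r₁ m)) ℝ :=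
  Matrix.of fun x s => P.Γ m x.1 s.2 * P.Λ m x.2 s.1

/-- The loadings of the vectorized observations on `Φ.vecs m`. -/
def loading (m : Fin M) :
    Matrix (Fin (P.N m) × Fin P.p) ((Fin k₂ × Fin k₁) ⊕ (Fin (r₂ m) × Fin (r₁ m))) ℝ :=
  Matrix.fromCols (P.globalLoading m) (P.localLoading m)

lemma vecX_eq (m : Fin M) (t : ℤ) (ω : Ω) :
    P.vecX Φ m t ω = P.loading m *ᵥ Φ.vecs m t ω + P.vecE m t ω := by
  funext x
  simp only [vecX, X, Matrix.add_apply, Pi.add_apply, vecE, loading, FactorProcess.vecs,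
    Matrix.mul_apply, Matrix.transpose_apply, Matrix.mulVec, dotProduct, Fintype.sum_sum_type,
    Fintype.sum_prod_type, Matrix.fromCols_apply_inl, Matrix.fromCols_apply_inr, Sum.elim_inl,
    Sum.elim_inr, Matrix.vec, globalLoading, localLoading, Matrix.of_apply, Finset.sum_mul]
  congr 2 <;>
  exact Finset.sum_congr rfl fun _ _ => Finset.sum_congr rfl fun _ _ => by ring

lemma sqSum_globalLoading (m : Fin M) :
    sqSum (P.globalLoading m) = sqSum (P.R m) * sqSum (P.C m) := sqSum_kronecker _ _

lemma sqSum_loading (m : Fin M) : sqSum (P.loading m) =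
    sqSum (P.R m) * sqSum (P.C m) + sqSum (P.Γ m) * sqSum (P.Λ m) := by
  rw [loading, sqSum_fromCols, globalLoading, localLoading, sqSum_kronecker, sqSum_kronecker]

end Panel

/-! ### Averages of outer products -/

/-- `T⁻¹ ∑_{t=1}^T u_t v_t'`. -/
noncomputable def avgOuter (T : ℕ) {α β : Type*} (u : ℤ → Ω → α → ℝ) (v : ℤ → Ω → β → ℝ) (ω : Ω) :
    Matrix α β ℝ :=
  (T : ℝ)⁻¹ • ∑ t ∈ Finset.Icc (1 : ℤ) T, Matrix.vecMulVec (u t ω) (v t ω)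

/-- `T⁻¹ ∑_{t=1}^T Cov(u_t, v_t)`. -/
noncomputable def avgCov [MeasurableSpace Ω] (μ : Measure Ω) (T : ℕ) {α β : Type*} (u : ℤ → Ω → α → ℝ)
    (v : ℤ → Ω → β → ℝ) : Matrix α β ℝ :=
  (T : ℝ)⁻¹ • ∑ t ∈ Finset.Icc (1 : ℤ) T, covMat μ (u t) (v t)

lemma avgOuter_apply (T : ℕ) {α β : Type*} (u : ℤ → Ω → α → ℝ) (v : ℤ → Ω → β → ℝ) (ω : Ω)
    (i : α) (j : β) : avgOuter T u v ω i j = timeAvg T (fun t ω => u t ω i * v t ω j) ω := by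
  simp [avgOuter, timeAvg, Matrix.smul_apply, Matrix.sum_apply, Matrix.vecMulVec_apply]

lemma avgOuter_mulVec_add (T : ℕ) {α β σ τ : Type*} [Fintype σ] [Fintype τ]
    (A : Matrix α σ ℝ) (B : Matrix β τ ℝ) (f : ℤ → Ω → σ → ℝ) (g : ℤ → Ω → τ → ℝ)
    (e : ℤ → Ω → α → ℝ) (e' : ℤ → Ω → β → ℝ) (ω : Ω) :
    avgOuter T (fun t ω => A *ᵥ f t ω + e t ω) (fun t ω => B *ᵥ g t ω + e' t ω) ω =
      A * avgOuter T f g ω * Bᵀ + A * avgOuter T f e' ω + avgOuter T e g ω * Bᵀ +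
        avgOuter T e e' ω := by
  simp only [avgOuter, Matrix.mul_smul, Matrix.smul_mul,
    ← smul_add, ← Finset.sum_add_distrib, Matrix.mul_sum, Matrix.sum_mul]
  congr 1
  refine Finset.sum_congr rfl fun t _ => ?_
  rw [Matrix.add_vecMulVec, Matrix.vecMulVec_add, Matrix.vecMulVec_add, Matrix.mul_vecMulVec,
    Matrix.mul_vecMulVec, Matrix.vecMulVec_mul, Matrix.vecMulVec_mul, Matrix.vecMul_transpose]
  abel

variable (P : Panel Ω M k₁ k₂ r₁ r₂) (Φ : FactorProcess Ω M k₁ k₂ r₁ r₂)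

lemma sampleOmega_apply (m i : Fin M) (x : Fin (P.N m) × Fin P.p) (y : Fin (P.N i) × Fin P.p)
    (ω : Ω) : sampleOmega (b := fun _ => P.p) (P.X Φ) P.T m i x.2 y.2 ω x.1 y.1 =
      avgOuter P.T (P.vecX Φ m) (P.vecX Φ i) ω x y := by
  simp [sampleOmega, avgOuter, Matrix.sum_apply, Matrix.vecMulVec_apply, Panel.vecX]

lemma popOmega_apply [MeasurableSpace Ω] (μ : Measure Ω) (m i : Fin M) (x : Fin (P.N m) × Fin P.p)
    (y : Fin (P.N i) × Fin P.p) :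
    popOmega (b := fun _ => P.p) (P.X Φ) P.T μ m i x.2 y.2 x.1 y.1 =
      avgCov μ P.T (P.vecX Φ m) (P.vecX Φ i) x y := by
  simp [popOmega, avgCov, Matrix.sum_apply, covMat, Panel.vecX]

/-- `popStack P Φ μ m` is the matrix `Y` with `W_{1,m} = Y'Y`. -/
noncomputable abbrev popStack [MeasurableSpace Ω] (P : Panel Ω M k₁ k₂ r₁ r₂)
    (Φ : FactorProcess Ω M k₁ k₂ r₁ r₂) (μ : Measure Ω) (m : Fin M) :=
  stack (a := P.N) (b := fun _ => P.p) (m := m) (popOmega (b := fun _ => P.p) (P.X Φ) P.T μ m)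

/-- `sampleStack P Φ m ω` is the matrix `X` with `Ŵ_{1,m} = X'X`. -/
noncomputable abbrev sampleStack (P : Panel Ω M k₁ k₂ r₁ r₂) (Φ : FactorProcess Ω M k₁ k₂ r₁ r₂)
    (m : Fin M) (ω : Ω) :=
  stack (a := P.N) (b := fun _ => P.p) (m := m) fun i j₁ j₂ => sampleOmega (b := fun _ => P.p) (P.X Φ) P.T m i j₁ j₂ ω

lemma W₁_eq_gram [MeasurableSpace Ω] (μ : Measure Ω) (m : Fin M) :
    P.W₁ Φ μ m = (popStack P Φ μ m)ᵀ * popStack P Φ μ m :=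
  sum_mul_transpose_eq_gram (a := P.N) (b := fun _ => P.p) (m := m)
    (popOmega (b := fun _ => P.p) (P.X Φ) P.T μ m)

lemma hatW₁_eq_gram (m : Fin M) (ω : Ω) :
    P.hatW₁ Φ m ω = (sampleStack P Φ m ω)ᵀ * sampleStack P Φ m ω :=
  sum_mul_transpose_eq_gram (a := P.N) (b := fun _ => P.p) (m := m) fun i j₁ j₂ =>
    sampleOmega (b := fun _ => P.p) (P.X Φ) P.T m i j₁ j₂ ω

end Model

/-! ### Moments of the factors -/

section FactorMoments

variable {Ω : Type*} [MeasurableSpace Ω] {μ : Measure Ω}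
  {M k₁ k₂ : ℕ} {r₁ r₂ : Fin M → ℕ} {Φ : FactorProcess Ω M k₁ k₂ r₁ r₂}
  {P : ℕ → Panel Ω M k₁ k₂ r₁ r₂}

lemma integrable_and_integral_le_of_lintegral_le {f : Ω → ℝ} {K : ℝ} (hf : Measurable f)
    (hf0 : ∀ ω, 0 ≤ f ω) (h : ∫⁻ ω, ENNReal.ofReal (f ω) ∂μ ≤ ENNReal.ofReal K) :
    Integrable f μ ∧ ∫ ω, f ω ∂μ ≤ max K 0 := by
  constructor
  · refine ⟨hf.aestronglyMeasurable, ?_⟩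
    rw [hasFiniteIntegral_iff_ofReal (ae_of_all _ hf0)]
    exact h.trans_lt ENNReal.ofReal_lt_top
  · rw [integral_eq_lintegral_of_nonneg_ae (ae_of_all _ hf0) hf.aestronglyMeasurable]
    refine ENNReal.toReal_le_of_le_ofReal (le_max_right _ _) (h.trans ?_)
    exact ENNReal.ofReal_le_ofReal (le_max_left _ _)

lemma CenteredFactors.measurable_vecs (hcent : CenteredFactors μ Φ) (m : Fin M) (t : ℤ) (s) :
    Measurable fun ω => Φ.vecs m t ω s := by
  rcases s with s | s
  · exact hcent.measurable_G t s.2 s.1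
  · exact hcent.measurable_F m t s.2 s.1

lemma CenteredFactors.measurable_joint (hcent : CenteredFactors μ Φ) (t : ℤ) :
    Measurable (Φ.joint t) := by
  refine measurable_pi_lambda _ fun s => ?_
  rcases s with s | s
  · exact hcent.measurable_G t s.2 s.1
  · exact hcent.measurable_F s.1 t s.2.2 s.2.1

lemma CenteredFactors.integral_vecs (hcent : CenteredFactors μ Φ) (m : Fin M) {t : ℤ}
    (ht : 1 ≤ t) (s) : ∫ ω, Φ.vecs m t ω s ∂μ = 0 := by
  rcases s with s | s
  · exact hcent.mean_G t ht s.2 s.1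
  · exact hcent.mean_F m t ht s.2 s.1

lemma exists_moment_bound_vecs {γ : ℝ} {h₀ : ℕ} (hcent : CenteredFactors μ Φ)
    (hmom : FactorMoments μ Φ P γ h₀) :
    ∃ K : ℝ, 0 ≤ K ∧ ∀ m (t : ℤ), 1 ≤ t → ∀ s,
      Integrable (fun ω => |Φ.vecs m t ω s| ^ (2 * γ)) μ ∧
        ∫ ω, |Φ.vecs m t ω s| ^ (2 * γ) ∂μ ≤ K := by
  obtain ⟨K, hG, hF⟩ := hmom.moments
  refine ⟨max K 0, le_max_right _ _, fun m t ht s => ?_⟩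
  refine integrable_and_integral_le_of_lintegral_le
    ((continuous_abs.measurable.comp (hcent.measurable_vecs m t s)).pow_const _)
    (fun ω => by positivity) ?_
  rcases s with s | s
  · exact hG t ht s.2 s.1
  · exact hF m t ht s.2 s.1

lemma abs_mul_rpow_le {γ : ℝ} (hγ : 0 ≤ γ) (x y : ℝ) :
    |x * y| ^ γ ≤ |x| ^ (2 * γ) + |y| ^ (2 * γ) := by
  have key : ∀ x y : ℝ, |y| ≤ |x| → |x * y| ^ γ ≤ |x| ^ (2 * γ) + |y| ^ (2 * γ) := by
    intro x y h
    have h1 : |x * y| ≤ |x| ^ (2 : ℝ) := by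
      rw [abs_mul, Real.rpow_two, sq]; exact mul_le_mul_of_nonneg_left h (abs_nonneg _)
    have h2 := Real.rpow_le_rpow (abs_nonneg _) h1 hγ
    rw [← Real.rpow_mul (abs_nonneg _)] at h2
    have : 0 ≤ |y| ^ (2 * γ) := by positivity
    linarith
  rcases le_total |y| |x| with h | h
  · exact key x y h
  · rw [mul_comm, add_comm]; exact key y x h

lemma memLp_two_of_integrable_rpow [IsProbabilityMeasure μ] {f : Ω → ℝ} {q : ℝ} (hq : 2 ≤ q) (hf : Measurable f)
    (hi : Integrable (fun ω => |f ω| ^ q) μ) : MemLp f 2 μ :=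
  (memLp_two_iff_integrable_sq hf.aestronglyMeasurable).2 <|
    ((integrable_const (1 : ℝ)).add hi).mono' (hf.pow_const 2).aestronglyMeasurable
      (ae_of_all _ fun ω => by
        rw [Real.norm_of_nonneg (sq_nonneg _)]; exact sq_le_one_add_rpow hq _)

lemma integral_sq_le_of_integrable_rpow [IsProbabilityMeasure μ] {f : Ω → ℝ} {q K : ℝ} (hq : 2 ≤ q) (hf : Measurable f)
    (hi : Integrable (fun ω => |f ω| ^ q) μ) (hK : ∫ ω, |f ω| ^ q ∂μ ≤ K) :
    ∫ ω, f ω ^ 2 ∂μ ≤ 1 + K := by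
  have h1 := integral_mono (memLp_two_of_integrable_rpow hq hf hi).integrable_sq
    ((integrable_const (1 : ℝ)).add hi) fun ω => sq_le_one_add_rpow hq (f ω)
  simp only [Pi.add_apply] at h1
  rw [integral_add (integrable_const _) hi] at h1
  simp only [integral_const, probReal_univ, smul_eq_mul, mul_one] at h1
  linarith

lemma exists_sq_bound_vecs [IsProbabilityMeasure μ] {γ : ℝ} {h₀ : ℕ} (hγ : 2 < γ) (hcent : CenteredFactors μ Φ)
    (hmom : FactorMoments μ Φ P γ h₀) :
    ∃ K : ℝ, 0 ≤ K ∧ ∀ m (t : ℤ), 1 ≤ t → ∀ s, MemLp (fun ω => Φ.vecs m t ω s) 2 μ ∧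
      ∫ ω, Φ.vecs m t ω s ^ 2 ∂μ ≤ K := by
  obtain ⟨K, hK0, hK⟩ := exists_moment_bound_vecs hcent hmom
  refine ⟨1 + K, by linarith, fun m t ht s => ⟨?_, ?_⟩⟩
  · exact memLp_two_of_integrable_rpow (by linarith) (hcent.measurable_vecs m t s) (hK m t ht s).1
  · exact integral_sq_le_of_integrable_rpow (by linarith) (hcent.measurable_vecs m t s)
      (hK m t ht s).1 (hK m t ht s).2

lemma covMat_vecs_apply (hcent : CenteredFactors μ Φ) (m i : Fin M) {t : ℤ} (ht : 1 ≤ t) (s s') :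
    covMat μ (Φ.vecs m t) (Φ.vecs i t) s s' = ∫ ω, Φ.vecs m t ω s * Φ.vecs i t ω s' ∂μ := by
  simp only [covMat, Matrix.of_apply, covariance, hcent.integral_vecs _ ht, sub_zero]

/-- The sample cross moments of the factors converge in mean square at the rate `T ^ (-1 / 2)`. -/
lemma exists_factor_avgOuter_bound [IsProbabilityMeasure μ] {γ : ℝ} {h₀ : ℕ} (hcent : CenteredFactors μ Φ)
    (hmix : FactorMixing μ Φ γ) (hmom : FactorMoments μ Φ P γ h₀) :
    ∃ C : ℝ, 0 ≤ C ∧ ∀ (m i : Fin M) (T : ℕ) s s',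
      MemLp (fun ω => (avgOuter T (Φ.vecs m) (Φ.vecs i) ω -
        avgCov μ T (Φ.vecs m) (Φ.vecs i)) s s') 2 μ ∧
      ∫ ω, (avgOuter T (Φ.vecs m) (Φ.vecs i) ω - avgCov μ T (Φ.vecs m) (Φ.vecs i)) s s' ^ 2 ∂μ
        ≤ C * (T : ℝ)⁻¹ := by
  have hγ := hmix.two_lt
  obtain ⟨K, hK0, hK⟩ := exists_moment_bound_vecs hcent hmom
  obtain ⟨C, hC0, hC⟩ := exists_integral_timeAvg_sq_le_of_mixing (K := 2 * K)
    hcent.measurable_joint hγ hmix.summable (by linarith)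
  refine ⟨C, hC0, fun m i T s s' => ?_⟩
  have hmeas : ∀ t, Measurable fun ω => Φ.vecs m t ω s * Φ.vecs i t ω s' := fun t =>
    (hcent.measurable_vecs m t s).mul (hcent.measurable_vecs i t s')
  have hi : ∀ t, 1 ≤ t → Integrable (fun ω => |Φ.vecs m t ω s * Φ.vecs i t ω s'| ^ γ) μ := by
    intro t ht
    refine ((hK m t ht s).1.add (hK i t ht s').1).mono'
      ((continuous_abs.measurable.comp (hmeas t)).pow_const _).aestronglyMeasurable
      (ae_of_all _ fun ω => ?_)
    rw [Real.norm_of_nonneg (by positivity)]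
    exact abs_mul_rpow_le (by linarith) _ _
  have hiK : ∀ t, 1 ≤ t → ∫ ω, |Φ.vecs m t ω s * Φ.vecs i t ω s'| ^ γ ∂μ ≤ 2 * K := by
    intro t ht
    have := integral_mono (hi t ht) ((hK m t ht s).1.add (hK i t ht s').1)
      fun ω => abs_mul_rpow_le (by linarith) _ _
    simp only [Pi.add_apply] at this
    rw [integral_add (hK m t ht s).1 (hK i t ht s').1] at this
    linarith [(hK m t ht s).2, (hK i t ht s').2]
  have hL : ∀ t, 1 ≤ t → MemLp (fun ω => Φ.vecs m t ω s * Φ.vecs i t ω s') 2 μ := fun t ht =>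
    memLp_two_of_integrable_rpow hγ.le (hmeas t) (hi t ht)
  have heq : (fun ω => (avgOuter T (Φ.vecs m) (Φ.vecs i) ω -
      avgCov μ T (Φ.vecs m) (Φ.vecs i)) s s') =
      timeAvg T fun t ω => Φ.vecs m t ω s * Φ.vecs i t ω s' -
        ∫ ω', Φ.vecs m t ω' s * Φ.vecs i t ω' s' ∂μ := by
    funext ω
    rw [Matrix.sub_apply, avgOuter_apply, avgCov, Matrix.smul_apply, Matrix.sum_apply, timeAvg,
      timeAvg, smul_eq_mul, ← mul_sub, ← Finset.sum_sub_distrib]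
    congr 1
    refine Finset.sum_congr rfl fun t ht => ?_
    rw [covMat_vecs_apply hcent m i (Finset.mem_Icc.1 ht).1]
  have hg := hC (fun v => v (jointIndex m s) * v (jointIndex i s'))
    ((measurable_pi_apply _).mul (measurable_pi_apply _))
  simp only [joint_jointIndex] at hg
  refine ⟨?_, ?_⟩
  · rw [heq]
    exact memLp_timeAvg fun t ht => (hL t ht.1).sub (memLp_const _)
  · simp_rw [congrFun heq]
    exact hg hi hiK hL T

end FactorMoments

/-! ### Moments of the errors -/

section Errors

variable {Ω : Type*} [MeasurableSpace Ω] {μ : Measure Ω}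
  {M k₁ k₂ : ℕ} {r₁ r₂ : Fin M → ℕ} {Φ : FactorProcess Ω M k₁ k₂ r₁ r₂}
  {P : ℕ → Panel Ω M k₁ k₂ r₁ r₂}

lemma WhiteNoise.measurable_vecE (hnoise : WhiteNoise μ Φ P) (n : ℕ) (m : Fin M) (t : ℤ) (x) :
    Measurable fun ω => (P n).vecE m t ω x := hnoise.measurable n m t x.1 x.2

lemma WhiteNoise.memLp_vecE (hnoise : WhiteNoise μ Φ P) (n : ℕ) (m : Fin M) {t : ℤ}
    (ht : t ∈ Set.Icc (1 : ℤ) (P n).T) (x) : MemLp (fun ω => (P n).vecE m t ω x) 2 μ :=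
  hnoise.memLp n m t ht x.1 x.2

lemma WhiteNoise.integral_vecE (hnoise : WhiteNoise μ Φ P) (n : ℕ) (m : Fin M) {t : ℤ}
    (ht : t ∈ Set.Icc (1 : ℤ) (P n).T) (x) : ∫ ω, (P n).vecE m t ω x ∂μ = 0 :=
  hnoise.mean n m t ht x.1 x.2

lemma exists_sq_bound_vecE (hnoise : WhiteNoise μ Φ P) (hbdd : BoundedNoise μ P) :
    ∃ K : ℝ, 0 ≤ K ∧ ∀ n m, ∀ t ∈ Set.Icc (1 : ℤ) (P n).T, ∀ x,
      ∫ ω, (P n).vecE m t ω x ^ 2 ∂μ ≤ K := by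
  obtain ⟨K, hK⟩ := hbdd
  refine ⟨max K 0, le_max_right _ _, fun n m t ht x => le_max_of_le_left ?_⟩
  have h := (le_abs_self _).trans ((hK n m t ht).1 (x.2, x.1) (x.2, x.1))
  simp only [Panel.SigmaE, covMat, Matrix.of_apply, covariance, Matrix.vec] at h
  simp only [hnoise.mean n m t ht, sub_zero, ← sq] at h
  exact h

/-- Functions of the errors at two times are independent of functions of the factors at two
times. -/
lemma WhiteNoise.indep_errors_factors (hnoise : WhiteNoise μ Φ P) (n : ℕ) (m i : Fin M)
    {t t' : ℤ} (ht : t ∈ Set.Icc (1 : ℤ) (P n).T) (ht' : t' ∈ Set.Icc (1 : ℤ) (P n).T) (x s)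
    {φ ψ : ℝ → ℝ → ℝ} (hφ : Measurable (Function.uncurry φ))
    (hψ : Measurable (Function.uncurry ψ)) :
    IndepFun (fun ω => φ ((P n).vecE m t ω x) ((P n).vecE m t' ω x))
      (fun ω => ψ (Φ.vecs i t ω s) (Φ.vecs i t' ω s)) μ := by
  have hg1 : Measurable fun v : (t : Set.Icc (1 : ℤ) (P n).T) →
      (Σ m : Fin M, Fin (P n).p × Fin ((P n).N m)) → ℝ =>
        (v ⟨t, ht⟩ ⟨m, (x.2, x.1)⟩, v ⟨t', ht'⟩ ⟨m, (x.2, x.1)⟩) := by fun_prop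
  have hg2 : Measurable fun v : (t : Set.Icc (1 : ℤ) (P n).T) →
      (Fin k₂ × Fin k₁) ⊕ (Σ m : Fin M, Fin (r₂ m) × Fin (r₁ m)) → ℝ =>
        (v ⟨t, ht⟩ (jointIndex i s), v ⟨t', ht'⟩ (jointIndex i s)) := by fun_prop
  have h := (hnoise.indep_factors n).comp (hφ.comp hg1) (hψ.comp hg2)
  have e : ∀ t ω, Φ.joint t ω (jointIndex i s) = Φ.vecs i t ω s :=
    fun t ω => joint_jointIndex Φ i t ω s
  simp only [Function.comp_def, Function.uncurry, e] at h
  exact h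

/-- Functions of the errors at two different times are independent. -/
lemma WhiteNoise.indep_errors (hnoise : WhiteNoise μ Φ P) (n : ℕ) (m i : Fin M)
    {t t' : ℤ} (ht : t ∈ Set.Icc (1 : ℤ) (P n).T) (ht' : t' ∈ Set.Icc (1 : ℤ) (P n).T)
    (hne : t ≠ t') (x y) {φ : ℝ → ℝ → ℝ} (hφ : Measurable (Function.uncurry φ)) :
    IndepFun (fun ω => φ ((P n).vecE m t ω x) ((P n).vecE i t ω y))
      (fun ω => φ ((P n).vecE m t' ω x) ((P n).vecE i t' ω y)) μ := by
  have h0 := (hnoise.indep_time n).indepFun (i := ⟨t, ht⟩) (j := ⟨t', ht'⟩)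
    (fun h => hne (congrArg Subtype.val h))
  have hm := hφ.comp (by fun_prop : Measurable fun v :
      (Σ m : Fin M, Fin (P n).p × Fin ((P n).N m)) → ℝ => (v ⟨m, (x.2, x.1)⟩, v ⟨i, (y.2, y.1)⟩))
  exact h0.comp hm hm

/-- The sample cross moments of errors and factors are of order `T ^ (-1 / 2)` in mean square. -/
lemma exists_error_factor_bound [IsProbabilityMeasure μ] {γ : ℝ} {h₀ : ℕ} (hγ : 2 < γ) (hcent : CenteredFactors μ Φ)
    (hmom : FactorMoments μ Φ P γ h₀) (hnoise : WhiteNoise μ Φ P) (hbdd : BoundedNoise μ P) :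
    ∃ C : ℝ, 0 ≤ C ∧ ∀ n (m i : Fin M) x s,
      MemLp (timeAvg (P n).T fun t ω => (P n).vecE m t ω x * Φ.vecs i t ω s) 2 μ ∧
      ∫ ω, timeAvg (P n).T (fun t ω => (P n).vecE m t ω x * Φ.vecs i t ω s) ω ^ 2 ∂μ
        ≤ C * ((P n).T : ℝ)⁻¹ := by
  obtain ⟨K, hK0, hK⟩ := exists_sq_bound_vecs hγ hcent hmom
  obtain ⟨K', hK'0, hK'⟩ := exists_sq_bound_vecE hnoise hbdd
  refine ⟨2 * (K' * K), by positivity, fun n m i x s => ?_⟩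
  have hsq : ∀ t ∈ Set.Icc (1 : ℤ) (P n).T, IndepFun (fun ω => (P n).vecE m t ω x ^ 2)
      (fun ω => Φ.vecs i t ω s ^ 2) μ := fun t ht =>
    hnoise.indep_errors_factors n m i ht ht x s (φ := fun a _ => a ^ 2) (ψ := fun a _ => a ^ 2)
      (by fun_prop) (by fun_prop)
  have hL : ∀ t ∈ Set.Icc (1 : ℤ) (P n).T,
      MemLp (fun ω => (P n).vecE m t ω x * Φ.vecs i t ω s) 2 μ := by
    intro t ht
    refine (memLp_two_iff_integrable_sq ((hnoise.measurable_vecE n m t x).mul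
      (hcent.measurable_vecs i t s)).aestronglyMeasurable).2 ?_
    simp_rw [Pi.mul_apply, mul_pow]
    exact (hsq t ht).integrable_mul (hnoise.memLp_vecE n m ht x).integrable_sq
      (hK i t ht.1 s).1.integrable_sq
  refine ⟨memLp_timeAvg hL, integral_timeAvg_sq_le_of_orthogonal (by positivity) hL ?_ ?_⟩
  · intro t ht
    simp_rw [mul_pow]
    rw [(hsq t ht).integral_fun_mul_eq_mul_integral
      (hnoise.memLp_vecE n m ht x).integrable_sq.aestronglyMeasurable
      (hK i t ht.1 s).1.integrable_sq.aestronglyMeasurable]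
    exact mul_le_mul (hK' n m t ht x) (hK i t ht.1 s).2 (integral_nonneg fun ω => sq_nonneg _) hK'0
  · intro t ht t' ht' hne
    have h1 := hnoise.indep_errors_factors n m i ht ht' x s (φ := fun a b => a * b)
      (ψ := fun a b => a * b) (by fun_prop) (by fun_prop)
    have h2 : ∀ ω, (P n).vecE m t ω x * Φ.vecs i t ω s * ((P n).vecE m t' ω x * Φ.vecs i t' ω s) =
        (P n).vecE m t ω x * (P n).vecE m t' ω x * (Φ.vecs i t ω s * Φ.vecs i t' ω s) :=
      fun ω => by ring
    have h3 := hnoise.indep_errors n m m ht ht' hne x x (φ := fun a _ => a) (by fun_prop)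
    simp_rw [h2]
    rw [h1.integral_fun_mul_eq_mul_integral
      ((hnoise.measurable_vecE n m t x).mul (hnoise.measurable_vecE n m t' x)).aestronglyMeasurable
      ((hcent.measurable_vecs i t s).mul (hcent.measurable_vecs i t' s)).aestronglyMeasurable,
      h3.integral_fun_mul_eq_mul_integral (hnoise.measurable_vecE n m t x).aestronglyMeasurable
      (hnoise.measurable_vecE n m t' x).aestronglyMeasurable, hnoise.integral_vecE n m ht x]
    simp

/-- The sample cross moments of the errors of different groups are of order `T ^ (-1 / 2)` in mean
square. -/
lemma exists_error_error_bound (hnoise : WhiteNoise μ Φ P) (hunc : Uncorrelated μ Φ P) :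
    ∃ C : ℝ, 0 ≤ C ∧ ∀ n (m i : Fin M), m ≠ i → ∀ x y,
      MemLp (timeAvg (P n).T fun t ω => (P n).vecE m t ω x * (P n).vecE i t ω y) 2 μ ∧
      ∫ ω, timeAvg (P n).T (fun t ω => (P n).vecE m t ω x * (P n).vecE i t ω y) ω ^ 2 ∂μ
        ≤ C * ((P n).T : ℝ)⁻¹ := by
  obtain ⟨K, hK⟩ := hnoise.cross_moment
  refine ⟨2 * max K 0, by positivity, fun n m i hmi x y => ?_⟩
  have hmeas : ∀ t, Measurable fun ω => (P n).vecE m t ω x * (P n).vecE i t ω y := fun t =>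
    (hnoise.measurable_vecE n m t x).mul (hnoise.measurable_vecE n i t y)
  have hsq : ∀ t ∈ Set.Icc (1 : ℤ) (P n).T,
      Integrable (fun ω => ((P n).vecE m t ω x * (P n).vecE i t ω y) ^ 2) μ ∧
      ∫ ω, ((P n).vecE m t ω x * (P n).vecE i t ω y) ^ 2 ∂μ ≤ max K 0 := fun t ht =>
    integrable_and_integral_le_of_lintegral_le ((hmeas t).pow_const 2) (fun ω => sq_nonneg _)
      (hK n m i hmi t ht x.1 x.2 y.1 y.2)
  have hL : ∀ t ∈ Set.Icc (1 : ℤ) (P n).T,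
      MemLp (fun ω => (P n).vecE m t ω x * (P n).vecE i t ω y) 2 μ := fun t ht =>
    (memLp_two_iff_integrable_sq (hmeas t).aestronglyMeasurable).2 (hsq t ht).1
  refine ⟨memLp_timeAvg hL, integral_timeAvg_sq_le_of_orthogonal (le_max_right _ _) hL
    (fun t ht => (hsq t ht).2) ?_⟩
  intro t ht t' ht' hne
  have h := hnoise.indep_errors n m i ht ht' hne x y (φ := fun a b => a * b) (by fun_prop)
  rw [h.integral_fun_mul_eq_mul_integral (hmeas t).aestronglyMeasurable
    (hmeas t').aestronglyMeasurable]
  have : ∫ ω, (P n).vecE m t ω x * (P n).vecE i t ω y ∂μ = 0 :=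
    hunc.EE n m i hmi t ht x.1 x.2 y.1 y.2
  simp [this]

end Errors

/-! ### The population matrices -/

section Population

variable {Ω : Type*} [MeasurableSpace Ω] {μ : Measure Ω}
  {M k₁ k₂ : ℕ} {r₁ r₂ : Fin M → ℕ} {Φ : FactorProcess Ω M k₁ k₂ r₁ r₂}
  {P : ℕ → Panel Ω M k₁ k₂ r₁ r₂} {γ : ℝ} {h₀ : ℕ}

/-- Neither the errors nor their correlation with the factors contribute to the covariances between
different groups. -/
lemma covMat_vecX [IsProbabilityMeasure μ] (hγ : 2 < γ) (hcent : CenteredFactors μ Φ)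
    (hmom : FactorMoments μ Φ P γ h₀) (hnoise : WhiteNoise μ Φ P) (hunc : Uncorrelated μ Φ P)
    (n : ℕ) {m i : Fin M} (hmi : m ≠ i) {t : ℤ} (ht : t ∈ Set.Icc (1 : ℤ) (P n).T) :
    covMat μ ((P n).vecX Φ m t) ((P n).vecX Φ i t) =
      (P n).loading m * covMat μ (Φ.vecs m t) (Φ.vecs i t) * ((P n).loading i)ᵀ := by
  obtain ⟨K, -, hK⟩ := exists_sq_bound_vecs hγ hcent hmom
  have hf := fun m s => (hK m t ht.1 s).1
  have he := fun m x => hnoise.memLp_vecE n m ht x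
  have hef : ∀ m i x s, covariance (fun ω => (P n).vecE m t ω x) (fun ω => Φ.vecs i t ω s) μ = 0 :=
    fun m i x s => (hnoise.indep_errors_factors n m i ht ht x s (φ := fun a _ => a)
      (ψ := fun a _ => a) (by fun_prop) (by fun_prop)).covariance_eq_zero (he m x) (hf i s)
  ext x y
  have hsum : ∀ m x, (fun ω => (P n).vecX Φ m t ω x) =
      (fun ω => ∑ s, (P n).loading m x s * Φ.vecs m t ω s) + fun ω => (P n).vecE m t ω x := by
    intro m x
    funext ω
    rw [Panel.vecX_eq]
    rfl
  have hL : ∀ m x s, MemLp (fun ω => (P n).loading m x s * Φ.vecs m t ω s) 2 μ :=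
    fun m x s => (hf m s).const_mul _
  have hLs : ∀ m x, MemLp (fun ω => ∑ s, (P n).loading m x s * Φ.vecs m t ω s) 2 μ :=
    fun m x => memLp_finsetSum _ fun s _ => hL m x s
  have hee : covariance (fun ω => (P n).vecE m t ω x) (fun ω => (P n).vecE i t ω y) μ = 0 := by
    simp only [covariance, hnoise.integral_vecE n _ ht, sub_zero]
    exact hunc.EE n m i hmi t ht x.1 x.2 y.1 y.2
  rw [covMat, Matrix.of_apply, hsum m x, hsum i y,
    covariance_add_left (hLs m x) (he m x) ((hLs i y).add (he i y)),
    covariance_add_right (hLs m x) (hLs i y) (he i y),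
    covariance_add_right (he m x) (hLs i y) (he i y), hee,
    covariance_fun_sum_fun_sum (hL m x) (hL i y),
    covariance_fun_sum_left (hL m x) (he i y), covariance_fun_sum_right (hL i y) (he m x)]
  simp only [covariance_const_mul_left, covariance_const_mul_right, hef,
    covariance_comm _ (fun ω => (P n).vecE i t ω y), mul_zero, Finset.sum_const_zero, add_zero]
  simp only [Matrix.mul_apply, Matrix.transpose_apply, covMat, Matrix.of_apply, Finset.sum_mul]
  rw [Finset.sum_comm]
  exact Finset.sum_congr rfl fun _ _ => Finset.sum_congr rfl fun _ _ => by ring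

lemma covMat_vecs_eq_fromBlocks (hcent : CenteredFactors μ Φ) (hunc : Uncorrelated μ Φ P)
    {m i : Fin M} (hmi : m ≠ i) {t : ℤ} (ht : 1 ≤ t) :
    covMat μ (Φ.vecs m t) (Φ.vecs i t) = Matrix.fromBlocks (Φ.SigmaG μ t) 0 0 0 := by
  ext s s'
  rcases s with s | s <;> rcases s' with s' | s'
  · rfl
  · rw [covMat_vecs_apply hcent m i ht]
    exact hunc.GF i t ht s.2 s.1 s'.2 s'.1
  · rw [covMat_vecs_apply hcent m i ht]
    exact (integral_congr_ae (ae_of_all _ fun ω => mul_comm _ _)).trans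
      (hunc.GF m t ht s'.2 s'.1 s.2 s.1)
  · rw [covMat_vecs_apply hcent m i ht]
    exact hunc.FF m i hmi t ht s.2 s.1 s'.2 s'.1

/-- `T⁻¹ ∑_{t=1}^T Var(vec G_t)`. -/
noncomputable def avgSigmaG (Φ : FactorProcess Ω M k₁ k₂ r₁ r₂) (μ : Measure Ω) (T : ℕ) :
    Matrix (Fin k₂ × Fin k₁) (Fin k₂ × Fin k₁) ℝ :=
  (T : ℝ)⁻¹ • ∑ t ∈ Finset.Icc (1 : ℤ) T, Φ.SigmaG μ t

lemma avgCov_vecX [IsProbabilityMeasure μ] (hγ : 2 < γ) (hcent : CenteredFactors μ Φ)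
    (hmom : FactorMoments μ Φ P γ h₀) (hnoise : WhiteNoise μ Φ P) (hunc : Uncorrelated μ Φ P)
    (n : ℕ) {m i : Fin M} (hmi : m ≠ i) :
    avgCov μ (P n).T ((P n).vecX Φ m) ((P n).vecX Φ i) =
      (P n).loading m * avgCov μ (P n).T (Φ.vecs m) (Φ.vecs i) * ((P n).loading i)ᵀ := by
  simp only [avgCov, Matrix.mul_smul, Matrix.smul_mul, Matrix.mul_sum, Matrix.sum_mul]
  congr 1
  exact Finset.sum_congr rfl fun t ht =>
    covMat_vecX hγ hcent hmom hnoise hunc n hmi (Finset.mem_Icc.1 ht)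

/-- Only the global factors correlate different groups. -/
lemma avgCov_vecX_eq_global [IsProbabilityMeasure μ] (hγ : 2 < γ) (hcent : CenteredFactors μ Φ)
    (hmom : FactorMoments μ Φ P γ h₀) (hnoise : WhiteNoise μ Φ P) (hunc : Uncorrelated μ Φ P)
    (n : ℕ) {m i : Fin M} (hmi : m ≠ i) :
    avgCov μ (P n).T ((P n).vecX Φ m) ((P n).vecX Φ i) =
      (P n).globalLoading m * avgSigmaG Φ μ (P n).T * ((P n).globalLoading i)ᵀ := by
  simp only [avgCov, avgSigmaG, Matrix.mul_smul, Matrix.smul_mul, Matrix.mul_sum, Matrix.sum_mul]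
  congr 1
  refine Finset.sum_congr rfl fun t ht => ?_
  rw [covMat_vecX hγ hcent hmom hnoise hunc n hmi (Finset.mem_Icc.1 ht),
    covMat_vecs_eq_fromBlocks hcent hunc hmi (Finset.mem_Icc.1 ht).1, Panel.loading, Panel.loading,
    Matrix.fromCols_mul_fromBlocks, Matrix.transpose_fromCols, Matrix.fromCols_mul_fromRows]
  simp

lemma exists_sqSum_avgSigmaG_le [Nonempty (Fin M)] [IsProbabilityMeasure μ] (hγ : 2 < γ)
    (hcent : CenteredFactors μ Φ) (hmom : FactorMoments μ Φ P γ h₀) :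
    ∃ C : ℝ, 0 ≤ C ∧ ∀ T, sqSum (avgSigmaG Φ μ T) ≤ C := by
  obtain ⟨K, hK0, hK⟩ := exists_sq_bound_vecs hγ hcent hmom
  obtain ⟨m⟩ := ‹Nonempty (Fin M)›
  refine ⟨_, ?_, fun T => sqSum_le_of_abs_le (K := K) fun s s' => ?_⟩
  · positivity
  have h1 : ∀ t ∈ Finset.Icc (1 : ℤ) T, |Φ.SigmaG μ t s s'| ≤ K := by
    intro t ht
    have ht1 := (Finset.mem_Icc.1 ht).1
    have e : Φ.SigmaG μ t s s' = ∫ ω, Φ.vecs m t ω (Sum.inl s) * Φ.vecs m t ω (Sum.inl s') ∂μ :=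
      covMat_vecs_apply hcent m m ht1 (Sum.inl s) (Sum.inl s')
    rw [e]
    have i1 := (hK m t ht1 (Sum.inl s)).1
    have i2 := (hK m t ht1 (Sum.inl s')).1
    refine abs_integral_le_integral_abs.trans ?_
    have h := integral_mono (i1.integrable_mul i2).abs
      ((i1.integrable_sq.add i2.integrable_sq).const_mul (1 / 2)) fun ω => ?_
    · rw [integral_const_mul] at h
      simp only [Pi.add_apply] at h
      rw [integral_add i1.integrable_sq i2.integrable_sq] at h
      have h2 := (hK m t ht1 (Sum.inl s)).2
      have h3 := (hK m t ht1 (Sum.inl s')).2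
      simp only [Pi.mul_apply] at h
      linarith
    · simp only [Pi.mul_apply, Pi.add_apply, abs_mul]
      nlinarith [sq_nonneg (|Φ.vecs m t ω (Sum.inl s)| - |Φ.vecs m t ω (Sum.inl s')|),
        sq_abs (Φ.vecs m t ω (Sum.inl s)), sq_abs (Φ.vecs m t ω (Sum.inl s'))]
  rw [avgSigmaG, Matrix.smul_apply, Matrix.sum_apply, smul_eq_mul, abs_mul,
    abs_of_nonneg (by positivity)]
  have h2 := (Finset.abs_sum_le_sum_abs _ _).trans (Finset.sum_le_card_nsmul _ _ _ h1)
  rw [Int.card_Icc, nsmul_eq_mul, show ((T : ℤ) + 1 - 1).toNat = T by simp] at h2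
  rcases Nat.eq_zero_or_pos T with h0 | h0
  · simpa [h0] using hK0
  · have : (0 : ℝ) < T := by positivity
    rw [inv_mul_le_iff₀ this]
    exact h2

lemma popStack_mulVec_eq_zero [IsProbabilityMeasure μ] (hγ : 2 < γ) (hcent : CenteredFactors μ Φ)
    (hmom : FactorMoments μ Φ P γ h₀) (hnoise : WhiteNoise μ Φ P) (hunc : Uncorrelated μ Φ P)
    (n : ℕ) (m : Fin M) (v : Fin ((P n).N m) → ℝ) (hv : ((P n).R m)ᵀ *ᵥ v = 0) :
    popStack (P n) Φ μ m *ᵥ v = 0 := by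
  funext ⟨⟨i, hi⟩, j₁, j₂, b⟩
  have h : ∀ a, popStack (P n) Φ μ m ⟨⟨i, hi⟩, j₁, j₂, b⟩ a = ∑ s : Fin k₂ × Fin k₁,
      (P n).R m a s.2 * ((P n).C m j₁ s.1 *
        (avgSigmaG Φ μ (P n).T * ((P n).globalLoading i)ᵀ) s (b, j₂)) := by
    intro a
    have h1 := popOmega_apply (P n) Φ μ m i (a, j₁) (b, j₂)
    rw [avgCov_vecX_eq_global hγ hcent hmom hnoise hunc n hi.symm, Matrix.mul_assoc,
      Matrix.mul_apply] at h1
    refine h1.trans (Finset.sum_congr rfl fun s _ => ?_)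
    simp only [Panel.globalLoading, Matrix.of_apply]
    ring
  simp only [Matrix.mulVec, dotProduct, h, Finset.sum_mul, Pi.zero_apply]
  rw [Finset.sum_comm]
  refine Finset.sum_eq_zero fun s _ => ?_
  have h2 := congrFun hv s.2
  simp only [Matrix.mulVec, dotProduct, Matrix.transpose_apply, Pi.zero_apply] at h2
  calc _ = (∑ a, (P n).R m a s.2 * v a) * ((P n).C m j₁ s.1 *
        (avgSigmaG Φ μ (P n).T * ((P n).globalLoading i)ᵀ) s (b, j₂)) := by
        rw [Finset.sum_mul]; exact Finset.sum_congr rfl fun _ _ => by ring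
    _ = 0 := by rw [h2, zero_mul]

lemma sqSum_popStack_le [IsProbabilityMeasure μ] (hγ : 2 < γ) (hcent : CenteredFactors μ Φ)
    (hmom : FactorMoments μ Φ P γ h₀) (hnoise : WhiteNoise μ Φ P) (hunc : Uncorrelated μ Φ P)
    (n : ℕ) (m : Fin M) :
    sqSum (popStack (P n) Φ μ m) ≤ ∑ i : {i : Fin M // i ≠ m},
      sqSum ((P n).globalLoading m) * sqSum (avgSigmaG Φ μ (P n).T) *
        sqSum ((P n).globalLoading i) := by
  rw [sqSum_stack]
  refine Finset.sum_le_sum fun i _ => ?_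
  have h : (Matrix.of fun (x : Fin ((P n).N m) × Fin (P n).p) (y : Fin ((P n).N i) × Fin (P n).p) =>
      popOmega (b := fun _ => (P n).p) ((P n).X Φ) (P n).T μ m i x.2 y.2 x.1 y.1) =
      (P n).globalLoading m * avgSigmaG Φ μ (P n).T * ((P n).globalLoading i)ᵀ := by
    ext x y
    rw [Matrix.of_apply, popOmega_apply, avgCov_vecX_eq_global hγ hcent hmom hnoise hunc n i.2.symm]
  rw [h]
  exact sqSum_mul_mul_transpose_le _ _ _

end Population

/-! ### Deviation of the sample from the population -/

section Deviation

variable {Ω : Type*} [MeasurableSpace Ω] {μ : Measure Ω}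
  {M k₁ k₂ : ℕ} {r₁ r₂ : Fin M → ℕ} {Φ : FactorProcess Ω M k₁ k₂ r₁ r₂}
  {P : ℕ → Panel Ω M k₁ k₂ r₁ r₂} {γ : ℝ} {h₀ : ℕ}

/-- The bound for the contribution of the groups `m` and `i` to the squared deviation of
`sampleStack` from `popStack` that comes from splitting both groups into factors and errors. -/
noncomputable def deviationBound (P : Panel Ω M k₁ k₂ r₁ r₂) (Φ : FactorProcess Ω M k₁ k₂ r₁ r₂)
    (μ : Measure Ω) (m i : Fin M) (ω : Ω) : ℝ :=
  4 * (sqSum (P.loading m) * sqSum (avgOuter P.T (Φ.vecs m) (Φ.vecs i) ω -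
        avgCov μ P.T (Φ.vecs m) (Φ.vecs i)) * sqSum (P.loading i) +
      sqSum (P.loading m) * sqSum (avgOuter P.T (Φ.vecs m) (P.vecE i) ω) +
      sqSum (avgOuter P.T (P.vecE m) (Φ.vecs i) ω) * sqSum (P.loading i) +
      sqSum (avgOuter P.T (P.vecE m) (P.vecE i) ω))

lemma sqSum_sampleStack_sub_le [IsProbabilityMeasure μ] (hγ : 2 < γ) (hcent : CenteredFactors μ Φ)
    (hmom : FactorMoments μ Φ P γ h₀) (hnoise : WhiteNoise μ Φ P) (hunc : Uncorrelated μ Φ P)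
    (n : ℕ) (m : Fin M) (ω : Ω) :
    sqSum (sampleStack (P n) Φ m ω - popStack (P n) Φ μ m) ≤
      ∑ i : {i : Fin M // i ≠ m}, deviationBound (P n) Φ μ m i ω := by
  rw [stack_sub, sqSum_stack]
  refine Finset.sum_le_sum fun i _ => ?_
  have h : (Matrix.of fun (x : Fin ((P n).N m) × Fin (P n).p) (y : Fin ((P n).N i) × Fin (P n).p) =>
      (sampleOmega (b := fun _ => (P n).p) ((P n).X Φ) (P n).T m i x.2 y.2 ω -
        popOmega (b := fun _ => (P n).p) ((P n).X Φ) (P n).T μ m i x.2 y.2) x.1 y.1) =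
      (P n).loading m * (avgOuter (P n).T (Φ.vecs m) (Φ.vecs i) ω -
        avgCov μ (P n).T (Φ.vecs m) (Φ.vecs i)) * ((P n).loading i)ᵀ +
      (P n).loading m * avgOuter (P n).T (Φ.vecs m) ((P n).vecE i) ω +
      avgOuter (P n).T ((P n).vecE m) (Φ.vecs i) ω * ((P n).loading i)ᵀ +
      avgOuter (P n).T ((P n).vecE m) ((P n).vecE i) ω := by
    ext x y
    rw [Matrix.of_apply, Matrix.sub_apply, sampleOmega_apply, popOmega_apply,
      avgCov_vecX hγ hcent hmom hnoise hunc n i.2.symm,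
      show (P n).vecX Φ m = fun t ω => (P n).loading m *ᵥ Φ.vecs m t ω + (P n).vecE m t ω from
        funext fun t => funext fun ω => Panel.vecX_eq _ _ _ _ _,
      show (P n).vecX Φ i = fun t ω => (P n).loading i *ᵥ Φ.vecs i t ω + (P n).vecE i t ω from
        funext fun t => funext fun ω => Panel.vecX_eq _ _ _ _ _,
      avgOuter_mulVec_add, ← Matrix.sub_apply, Matrix.mul_sub, Matrix.sub_mul]
    refine congrFun (congrFun ?_ x) y
    abel
  rw [h, deviationBound]
  refine (sqSum_add_le _ _ _ _).trans ?_
  have h1 := sqSum_mul_mul_transpose_le ((P n).loading m)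
    (avgOuter (P n).T (Φ.vecs m) (Φ.vecs i) ω - avgCov μ (P n).T (Φ.vecs m) (Φ.vecs i))
    ((P n).loading i)
  have h2 := sqSum_mul_le ((P n).loading m) (avgOuter (P n).T (Φ.vecs m) ((P n).vecE i) ω)
  have h3 := sqSum_mul_le (avgOuter (P n).T ((P n).vecE m) (Φ.vecs i) ω) ((P n).loading i)ᵀ
  rw [sqSum_transpose] at h3
  linarith

lemma integral_sqSum_le {ι κ : Type*} [Fintype ι] [Fintype κ] {Z : Ω → Matrix ι κ ℝ} {c : ℝ}
    (hZ : ∀ i j, MemLp (fun ω => Z ω i j) 2 μ ∧ ∫ ω, Z ω i j ^ 2 ∂μ ≤ c) :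
    Integrable (fun ω => sqSum (Z ω)) μ ∧
      ∫ ω, sqSum (Z ω) ∂μ ≤ Fintype.card ι * Fintype.card κ * c := by
  have hi : ∀ i j, Integrable (fun ω => Z ω i j ^ 2) μ := fun i j => (hZ i j).1.integrable_sq
  refine ⟨integrable_finsetSum _ fun i _ => integrable_finsetSum _ fun j _ => hi i j, ?_⟩
  simp only [sqSum]
  rw [integral_finsetSum _ fun i _ => integrable_finsetSum _ fun j _ => hi i j]
  simp_rw [integral_finsetSum _ fun j (_ : j ∈ Finset.univ) => hi _ j]
  refine (Finset.sum_le_sum fun i _ => Finset.sum_le_sum fun j _ => (hZ i j).2).trans ?_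
  simp [mul_assoc]

/-- The expected squared deviation is of order `N² p² / T` as soon as the squared Frobenius norms of
the loadings are at most of order `N p`. -/
lemma exists_integral_deviationBound_le [IsProbabilityMeasure μ] (hcent : CenteredFactors μ Φ)
    (hmix : FactorMixing μ Φ γ) (hmom : FactorMoments μ Φ P γ h₀) (hnoise : WhiteNoise μ Φ P)
    (hbdd : BoundedNoise μ P) (hunc : Uncorrelated μ Φ P) {m i : Fin M} (hmi : m ≠ i) {L : ℝ}
    (hL : ∀ j, ∀ᶠ n in atTop, sqSum ((P n).loading j) ≤ L * ((P n).total * (P n).p)) :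
    (∀ n, Integrable (deviationBound (P n) Φ μ m i) μ) ∧
    ∃ C : ℝ, 0 ≤ C ∧ ∀ᶠ n in atTop, ∫ ω, deviationBound (P n) Φ μ m i ω ∂μ ≤
      C * (((P n).total : ℝ) ^ 2 * ((P n).p : ℝ) ^ 2 * ((P n).T : ℝ)⁻¹) := by
  obtain ⟨A, hA0, hA⟩ := exists_factor_avgOuter_bound hcent hmix hmom
  obtain ⟨B, hB0, hB⟩ := exists_error_factor_bound hmix.two_lt hcent hmom hnoise hbdd
  obtain ⟨D, hD0, hD⟩ := exists_error_error_bound hnoise hunc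
  have i1 := fun n => integral_sqSum_le fun s s' => hA m i (P n).T s s'
  have i2 := fun n => integral_sqSum_le (μ := μ)
    (Z := avgOuter (P n).T (Φ.vecs m) ((P n).vecE i)) (c := B * ((P n).T : ℝ)⁻¹) fun s y => by
      simp only [avgOuter_apply]
      simpa only [mul_comm] using hB n i m y s
  have i3 := fun n => integral_sqSum_le (μ := μ)
    (Z := avgOuter (P n).T ((P n).vecE m) (Φ.vecs i)) (c := B * ((P n).T : ℝ)⁻¹) fun x s => by
      simp only [avgOuter_apply]
      exact hB n m i x s
  have i4 := fun n => integral_sqSum_le (μ := μ)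
    (Z := avgOuter (P n).T ((P n).vecE m) ((P n).vecE i)) (c := D * ((P n).T : ℝ)⁻¹) fun x y => by
      simp only [avgOuter_apply]
      exact hD n m i hmi x y
  have j1 := fun n => ((i1 n).1.const_mul (sqSum ((P n).loading m))).mul_const
    (sqSum ((P n).loading i))
  have j2 := fun n => (i2 n).1.const_mul (sqSum ((P n).loading m))
  have j3 := fun n => (i3 n).1.mul_const (sqSum ((P n).loading i))
  refine ⟨fun n => ((((j1 n).add (j2 n)).add (j3 n)).add (i4 n).1).const_mul 4, ?_⟩
  set qm : ℝ := ((Fintype.card ((Fin k₂ × Fin k₁) ⊕ (Fin (r₂ m) × Fin (r₁ m))) : ℕ) : ℝ)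
  set qi : ℝ := ((Fintype.card ((Fin k₂ × Fin k₁) ⊕ (Fin (r₂ i) × Fin (r₁ i))) : ℕ) : ℝ)
  have hqm : 0 ≤ qm := Nat.cast_nonneg _
  have hqi : 0 ≤ qi := Nat.cast_nonneg _
  refine ⟨4 * (|L| * (qm * qi * A) * |L| + |L| * (qm * B) + qi * B * |L| + D), by positivity, ?_⟩
  filter_upwards [hL m, hL i] with n hm hi
  have hint : ∫ ω, deviationBound (P n) Φ μ m i ω ∂μ =
      4 * (sqSum ((P n).loading m) * (∫ ω, sqSum (avgOuter (P n).T (Φ.vecs m) (Φ.vecs i) ω -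
        avgCov μ (P n).T (Φ.vecs m) (Φ.vecs i)) ∂μ) * sqSum ((P n).loading i) +
      sqSum ((P n).loading m) * (∫ ω, sqSum (avgOuter (P n).T (Φ.vecs m) ((P n).vecE i) ω) ∂μ) +
      (∫ ω, sqSum (avgOuter (P n).T ((P n).vecE m) (Φ.vecs i) ω) ∂μ) * sqSum ((P n).loading i) +
      ∫ ω, sqSum (avgOuter (P n).T ((P n).vecE m) ((P n).vecE i) ω) ∂μ) := by
    simp only [deviationBound]
    rw [integral_const_mul, integral_add (by exact ((j1 n).add (j2 n)).add (j3 n)) (i4 n).1,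
      integral_add (by exact (j1 n).add (j2 n)) (j3 n), integral_add (j1 n) (j2 n),
      integral_mul_const, integral_mul_const, integral_const_mul, integral_const_mul]
  have hN : ∀ j, ((P n).N j : ℝ) ≤ (P n).total := fun j => by
    exact_mod_cast Finset.single_le_sum (f := (P n).N) (fun _ _ => Nat.zero_le _)
      (Finset.mem_univ j)
  have h1 := (i1 n).2
  have h2 := (i2 n).2
  have h3 := (i3 n).2
  have h4 := (i4 n).2
  simp only [Fintype.card_prod, Fintype.card_fin, Nat.cast_mul] at h2 h3 h4
  have hNm := hN m
  have hNi := hN i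
  rw [hint]
  set N : ℝ := ((P n).total : ℝ)
  set p : ℝ := ((P n).p : ℝ)
  set τ : ℝ := ((P n).T : ℝ)⁻¹
  have hN0 : 0 ≤ N := Nat.cast_nonneg _
  have hp0 : 0 ≤ p := Nat.cast_nonneg _
  have hτ0 : 0 ≤ τ := inv_nonneg.2 (Nat.cast_nonneg _)
  have hm' : sqSum ((P n).loading m) ≤ |L| * (N * p) :=
    hm.trans (mul_le_mul_of_nonneg_right (le_abs_self _) (by positivity))
  have hi' : sqSum ((P n).loading i) ≤ |L| * (N * p) :=
    hi.trans (mul_le_mul_of_nonneg_right (le_abs_self _) (by positivity))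
  have hm0 := sqSum_nonneg ((P n).loading m)
  have hi0 := sqSum_nonneg ((P n).loading i)
  have hnn : ∀ {ι κ : Type} [Fintype ι] [Fintype κ] (Z : Ω → Matrix ι κ ℝ),
      0 ≤ ∫ ω, sqSum (Z ω) ∂μ := fun Z => integral_nonneg fun ω => sqSum_nonneg _
  have h2' : ∫ ω, sqSum (avgOuter (P n).T (Φ.vecs m) ((P n).vecE i) ω) ∂μ ≤
      qm * (N * p) * (B * τ) := h2.trans (by gcongr)
  have h3' : ∫ ω, sqSum (avgOuter (P n).T ((P n).vecE m) (Φ.vecs i) ω) ∂μ ≤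
      N * p * qi * (B * τ) := h3.trans (by gcongr)
  have h4' : ∫ ω, sqSum (avgOuter (P n).T ((P n).vecE m) ((P n).vecE i) ω) ∂μ ≤
      N * p * (N * p) * (D * τ) := h4.trans (by gcongr)
  calc _ ≤ 4 * (|L| * (N * p) * (qm * qi * (A * τ)) * (|L| * (N * p)) +
        |L| * (N * p) * (qm * (N * p) * (B * τ)) +
        N * p * qi * (B * τ) * (|L| * (N * p)) + N * p * (N * p) * (D * τ)) := by
        have e1 := mul_le_mul (mul_le_mul hm' h1 (hnn _) (by positivity)) hi' hi0 (by positivity)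
        have e2 := mul_le_mul hm' h2' (hnn _) (by positivity)
        have e3 := mul_le_mul h3' hi' hi0 (by positivity)
        linarith
    _ = _ := by ring

end Deviation

/-! ### Rates -/

section Rates

variable {Ω : Type*} [MeasurableSpace Ω] {μ : Measure Ω}
  {M k₁ k₂ : ℕ} {r₁ r₂ : Fin M → ℕ}

lemma HasStrength.exists_sqSum_le {a : ℕ → ℕ} {b : ℕ}
    {A : ∀ n, Matrix (Fin (a n)) (Fin b) ℝ} {rate : ℕ → ℝ} (h : HasStrength (b := fun _ => b) A rate)
    (hrate : ∀ n, 0 ≤ rate n) : ∃ c : ℝ, 0 ≤ c ∧ ∀ᶠ n in atTop, sqSum (A n) ≤ c * rate n := by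
  obtain ⟨c, hc, hb⟩ := h.1.1.exists_nonneg
  refine ⟨b * c, by positivity, hb.bound.mono fun n hn => ?_⟩
  rw [Real.norm_of_nonneg (sq_nonneg _), Real.norm_of_nonneg (hrate n)] at hn
  refine (sqSum_le_specNorm (A n)).trans ?_
  rw [Fintype.card_fin, mul_assoc]
  exact mul_le_mul_of_nonneg_left hn (Nat.cast_nonneg _)

/-- Markov's inequality: `X` is `O_p(a)` if it is controlled by a `D` with expectation `O(b)`. -/
lemma isBigOp_of_integral_le [IsFiniteMeasure μ] {X D : ℕ → Ω → ℝ} {a b : ℕ → ℝ} {A B C : ℝ}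
    (hC : 0 ≤ C)
    (hD0 : ∀ n ω, 0 ≤ D n ω) (hDi : ∀ n, Integrable (D n) μ)
    (hb : ∀ᶠ n in atTop, 0 < b n) (hD : ∀ᶠ n in atTop, ∫ ω, D n ω ∂μ ≤ C * b n)
    (hX : ∀ᶠ n in atTop, ∀ ω, ∀ x : ℝ, 0 ≤ x → D n ω ≤ x * b n → |X n ω| ≤ (A + B * x) * a n) :
    IsBigOp μ X a := by
  intro ε hε
  have hx : 0 < (C + 1) / ε := by positivity
  refine ⟨A + B * ((C + 1) / ε), ?_⟩
  filter_upwards [hb, hD, hX] with n hb hD hX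
  have hsub : {ω | (A + B * ((C + 1) / ε)) * a n < |X n ω|} ⊆
      {ω | (C + 1) / ε * b n ≤ D n ω} := by
    intro ω hω
    by_contra h
    exact absurd (hX ω _ hx.le (not_le.1 h).le) (not_le.2 hω)
  refine (measure_mono hsub).trans ?_
  rw [← ofReal_measureReal]
  refine ENNReal.ofReal_le_ofReal ?_
  have h := mul_meas_ge_le_integral_of_nonneg (ae_of_all μ (hD0 n)) (hDi n) ((C + 1) / ε * b n)
  have h1 : (C + 1) / ε * b n * μ.real {ω | (C + 1) / ε * b n ≤ D n ω} ≤ (C + 1) * b n :=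
    (h.trans hD).trans (by linarith)
  have h2 : (C + 1) / ε * b n * ε = (C + 1) * b n := by field_simp
  rw [← h2] at h1
  exact le_of_mul_le_mul_left h1 (by positivity)

end Rates

end MultilevelFactor

open MultilevelFactor
theorem theorem2 {Ω : Type*} [MeasurableSpace Ω] (μ : Measure Ω) [IsProbabilityMeasure μ]
    {M k₁ k₂ : ℕ} {r₁ r₂ : Fin M → ℕ}
    (Φ : FactorProcess Ω M k₁ k₂ r₁ r₂) (P : ℕ → Panel Ω M k₁ k₂ r₁ r₂)
    (γ δ₁ δ₂ δ₃ δ₄ : ℝ) (h₀ : ℕ)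
    (hsize : SizesTendToInfinity P)
    (hcent : CenteredFactors μ Φ)
    (hnoise : WhiteNoise μ Φ P)
    (hmix : FactorMixing μ Φ γ)
    (hmom : FactorMoments μ Φ P γ h₀)
    (hbdd : BoundedNoise μ P)
    (hstr : FactorStrength μ Φ P δ₁ δ₂ δ₃ δ₄)
    (heig : DistinctEigenvalues μ Φ P)
    (hunc : Uncorrelated μ Φ P)
    (hcomp : ComparableGroups P)
    (hrate : Tendsto (fun n => ((P n).total : ℝ) ^ δ₁ * ((P n).p : ℝ) ^ δ₂ *
      ((P n).T : ℝ) ^ (-(1 / 2) : ℝ)) atTop (𝓝 0))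
    (m : Fin M) :
    -- only the first `k₁` eigenvalues of `W` are nonzero
    (∀ n j, k₁ < j → j ≤ (P n).N m → eigDesc ((P n).W₁ Φ μ m) j = 0) ∧
    -- the first `k₁` sample eigenvalues
    (∀ j, 1 ≤ j → j ≤ k₁ →
      IsBigOp μ
        (fun n ω => eigDesc ((P n).hatW₁ Φ m ω) j - eigDesc ((P n).W₁ Φ μ m) j)
        (fun n => ((P n).total : ℝ) ^ (2 - δ₁) * ((P n).p : ℝ) ^ (2 - δ₂) *
          ((P n).T : ℝ) ^ (-(1 / 2) : ℝ))) ∧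
    -- the remaining ones, where the index may depend on `n`
    (∀ j : ℕ → ℕ, (∀ᶠ n in atTop, k₁ < j n ∧ j n ≤ (P n).N m) →
      IsBigOp μ
        (fun n ω => eigDesc ((P n).hatW₁ Φ m ω) (j n))
        (fun n => ((P n).total : ℝ) ^ 2 * ((P n).p : ℝ) ^ 2 * ((P n).T : ℝ)⁻¹)) := by
  have hγ := hmix.two_lt
  have hvanish := popStack_mulVec_eq_zero hγ hcent hmom hnoise hunc
  have hN1 : ∀ᶠ n in atTop, (1 : ℝ) ≤ (P n).total :=
    (hsize.N.eventually_ge_atTop 1).mono fun n hn => by exact_mod_cast hn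
  have hp1 : ∀ᶠ n in atTop, (1 : ℝ) ≤ (P n).p :=
    (hsize.p.eventually_ge_atTop 1).mono fun n hn => by exact_mod_cast hn
  have hT1 : ∀ᶠ n in atTop, (1 : ℝ) ≤ (P n).T :=
    (hsize.T.eventually_ge_atTop 1).mono fun n hn => by exact_mod_cast hn
  obtain ⟨⟨hδ₁, -⟩, ⟨hδ₂, -⟩, ⟨hδ₃, -⟩, ⟨hδ₄, -⟩⟩ := hstr.mem
  choose cR hcR0 hcR using fun i => (hstr.R i).exists_sqSum_le fun n => by positivity
  choose cC hcC0 hcC using fun i => (hstr.C i).exists_sqSum_le fun n => by positivity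
  choose cΓ hcΓ0 hcΓ using fun i => (hstr.Γ i).exists_sqSum_le fun n => by positivity
  choose cΛ hcΛ0 hcΛ using fun i => (hstr.Λ i).exists_sqSum_le fun n => by positivity
  have hG : ∀ i, ∀ᶠ n in atTop, sqSum ((P n).globalLoading i) ≤
      cR i * cC i * (((P n).total : ℝ) ^ (1 - δ₁) * ((P n).p : ℝ) ^ (1 - δ₂)) := by
    intro i
    filter_upwards [hcR i, hcC i] with n h1 h2
    rw [Panel.sqSum_globalLoading]
    refine (mul_le_mul h1 h2 (sqSum_nonneg _) ?_).trans (le_of_eq (by ring))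
    have := hcR0 i
    positivity
  -- `1 - δ ≤ 1` bounds all loadings by the same rate `N p`, strong or weak.
  set L : ℝ := ∑ i, (cR i * cC i + cΓ i * cΛ i) with hLdef
  have hL : ∀ i, ∀ᶠ n in atTop, sqSum ((P n).loading i) ≤ L * ((P n).total * (P n).p) := by
    intro i
    filter_upwards [hcR i, hcC i, hcΓ i, hcΛ i, hN1, hp1] with n h1 h2 h3 h4 hN hp
    have hpow : ∀ {x δ : ℝ}, 1 ≤ x → 0 ≤ δ → x ^ (1 - δ) ≤ x := fun hx hδ =>
      (Real.rpow_le_rpow_of_exponent_le hx (by linarith)).trans_eq (Real.rpow_one _)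
    have g1 := h1.trans (mul_le_mul_of_nonneg_left (hpow hN hδ₁) (hcR0 i))
    have g2 := h2.trans (mul_le_mul_of_nonneg_left (hpow hp hδ₂) (hcC0 i))
    have g3 := h3.trans (mul_le_mul_of_nonneg_left (hpow hN hδ₃) (hcΓ0 i))
    have g4 := h4.trans (mul_le_mul_of_nonneg_left (hpow hp hδ₄) (hcΛ0 i))
    rw [Panel.sqSum_loading]
    have g5 := mul_le_mul g1 g2 (sqSum_nonneg _) (mul_nonneg (hcR0 i) (by positivity))
    have g6 := mul_le_mul g3 g4 (sqSum_nonneg _) (mul_nonneg (hcΓ0 i) (by positivity))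
    have g7 : cR i * cC i + cΓ i * cΛ i ≤ L :=
      Finset.single_le_sum (f := fun i => cR i * cC i + cΓ i * cΛ i)
        (fun i _ => add_nonneg (mul_nonneg (hcR0 i) (hcC0 i)) (mul_nonneg (hcΓ0 i) (hcΛ0 i)))
        (Finset.mem_univ i)
    have g8 := mul_le_mul_of_nonneg_right g7
      (show (0 : ℝ) ≤ (P n).total * (P n).p by positivity)
    linarith
  set D : ℕ → Ω → ℝ := fun n ω => ∑ i : {i : Fin M // i ≠ m}, deviationBound (P n) Φ μ m i ω
    with hDdef
  have hDle := fun n ω => sqSum_sampleStack_sub_le hγ hcent hmom hnoise hunc n m ω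
  have hD0 : ∀ n ω, 0 ≤ D n ω := fun n ω => (sqSum_nonneg _).trans (hDle n ω)
  have hdev := fun i : {i : Fin M // i ≠ m} =>
    exists_integral_deviationBound_le hcent hmix hmom hnoise hbdd hunc i.2.symm hL
  choose hDi C hC0 hC using hdev
  have hDint : ∀ n, Integrable (D n) μ := fun n => integrable_finsetSum _ fun i _ => hDi i n
  have hDb : ∀ᶠ n in atTop, ∫ ω, D n ω ∂μ ≤
      (∑ i, C i) * (((P n).total : ℝ) ^ 2 * ((P n).p : ℝ) ^ 2 * ((P n).T : ℝ)⁻¹) := by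
    filter_upwards [eventually_all.2 hC] with n hn
    simp only [hDdef]
    rw [integral_finsetSum _ fun i _ => hDi i n, Finset.sum_mul]
    exact Finset.sum_le_sum fun i _ => hn i
  have hCsum : 0 ≤ ∑ i, C i := Finset.sum_nonneg fun i _ => hC0 i
  have hbpos : ∀ᶠ n in atTop,
      0 < ((P n).total : ℝ) ^ 2 * ((P n).p : ℝ) ^ 2 * ((P n).T : ℝ)⁻¹ := by
    filter_upwards [hN1, hp1, hT1] with n hN hp hT
    positivity
  refine ⟨fun n j hj hjN => ?_, fun j hj1 hjk => ?_, fun j hj => ?_⟩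
  · rw [W₁_eq_gram]
    refine le_antisymm ?_ (eigDesc_nonneg (posSemidef_gram _))
    refine (eigDesc_gram_le_of_vanish _ _ ((P n).R m)ᵀ (hvanish n m) hj hjN).trans_eq ?_
    simp [sqSum]
  · have : Nonempty (Fin M) := ⟨m⟩
    obtain ⟨S, hS0, hS⟩ := exists_sqSum_avgSigmaG_le hγ hcent hmom
    set A : ℝ := ∑ i : {i : Fin M // i ≠ m}, cR m * cC m * S * (cR i * cC i) with hA
    refine isBigOp_of_integral_le (A := A) (B := 2) hCsum hD0 hDint hbpos hDb ?_
    filter_upwards [eventually_all.2 hG, hN1, hp1, hT1, hrate.eventually_le_const zero_lt_one]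
      with n hGn hN hp hT hτ1 ω x hx hDx
    rw [W₁_eq_gram, hatW₁_eq_gram]
    have hY := sqSum_popStack_le hγ hcent hmom hnoise hunc n m
    set N : ℝ := ((P n).total : ℝ)
    set p : ℝ := ((P n).p : ℝ)
    set T : ℝ := ((P n).T : ℝ)
    have hN0 : 0 < N := by linarith
    have hp0 : 0 < p := by linarith
    have hT0 : 0 < T := by linarith
    set τ : ℝ := N ^ δ₁ * p ^ δ₂ * T ^ (-(1 / 2) : ℝ) with hτdef
    have hτ0 : 0 < τ := by positivity
    set g : ℝ := N ^ (1 - δ₁) * p ^ (1 - δ₂) with hg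
    set a : ℝ := N ^ (2 - δ₁) * p ^ (2 - δ₂) * T ^ (-(1 / 2) : ℝ) with ha
    set b : ℝ := N ^ 2 * p ^ 2 * T⁻¹ with hb
    have ha0 : 0 < a := by positivity
    have hsplit : ∀ {x δ : ℝ}, 0 < x → x ^ δ * (x ^ (1 - δ) * x ^ (1 - δ)) = x ^ (2 - δ) ∧
        x ^ δ * x ^ (2 - δ) = x ^ 2 := by
      intro x δ hx
      constructor
      · rw [← Real.rpow_add hx, ← Real.rpow_add hx]; ring_nf
      · rw [← Real.rpow_add hx, ← Real.rpow_two]; ring_nf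
    -- `τ` is chosen to make the two parts of the perturbation bound of the same order `a`
    have e1 : τ * (g * g) = a := by
      rw [hτdef, hg, ha, ← (hsplit hN0).1, ← (hsplit hp0).1]; ring
    have e2 : τ * a = b := by
      have hT2 : T ^ (-(1 / 2) : ℝ) * T ^ (-(1 / 2) : ℝ) = T⁻¹ := by
        rw [← Real.rpow_add hT0, ← Real.rpow_neg_one]; norm_num
      rw [hτdef, ha, hb, ← (hsplit (δ := δ₁) hN0).2, ← (hsplit (δ := δ₂) hp0).2, ← hT2]; ring
    have hYS : sqSum (popStack (P n) Φ μ m) ≤ A * (g * g) := by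
      refine hY.trans ?_
      rw [hA, Finset.sum_mul]
      refine Finset.sum_le_sum fun i _ => ?_
      have c1 := mul_nonneg (hcR0 m) (hcC0 m)
      have c2 := mul_nonneg (hcR0 i) (hcC0 i)
      refine (mul_le_mul (mul_le_mul (hGn m) (hS _) (sqSum_nonneg _) (by positivity)) (hGn i)
        (sqSum_nonneg _) (by positivity)).trans (le_of_eq (by ring))
    refine (abs_eigDesc_gram_sub_le _ _ hτ0 hj1).trans ?_
    have hd := (hDle n ω).trans hDx
    have f1 := mul_le_mul_of_nonneg_left hYS hτ0.le
    have f2 := mul_le_mul_of_nonneg_left hd (show 0 ≤ 1 + τ⁻¹ by positivity)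
    have f3 : b ≤ a := by rw [← e2]; exact mul_le_of_le_one_left ha0.le hτ1
    have f4 : τ⁻¹ * b = a := by rw [← e2]; field_simp
    calc _ ≤ τ * (A * (g * g)) + (1 + τ⁻¹) * (x * b) := add_le_add f1 f2
      _ = A * (τ * (g * g)) + x * b + x * (τ⁻¹ * b) := by ring
      _ = A * a + x * b + x * a := by rw [e1, f4]
      _ ≤ (A + 2 * x) * a := by nlinarith [mul_le_mul_of_nonneg_left f3 hx]
  · refine isBigOp_of_integral_le (A := 0) (B := 1) hCsum hD0 hDint hbpos hDb ?_
    filter_upwards [hj] with n hjn ω x hx hDx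
    rw [hatW₁_eq_gram, abs_of_nonneg (eigDesc_nonneg (posSemidef_gram _)), zero_add, one_mul]
    exact (eigDesc_gram_le_of_vanish _ _ ((P n).R m)ᵀ (hvanish n m) hjn.1 hjn.2).trans
      ((hDle n ω).trans hDx)
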